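/- Let $K$ be any field. For a finite group $\Gamma$, let $\Gamma$ act on the rational function field $K(x(g):g\in \Gamma)$ by $K$-automorphisms via $h\cdot x(g)=x(hg)$ and let $K(\Gamma)=K(x(g):g\in \Gamma)^{\Gamma}$ be the fixed field. A field $L\supseteq K$ is called *rational* over $K$ if it is purely transcendental over $K$; *stably rational* over $K$ if, for some integer $m\ge 0$, the rational function field $L(w_1,\dots,w_m)$ in $m$ variables is rational over $K$; and *retract rational* over $K$ if $L$ is the quotient field of a $K$-algebra domain $A$ for which there are an integer $n\ge 0$, a nonzero polynomial $f\in K[x_1,\dots,x_n]$ and $K$-algebra homomorphisms $\varphi:A\to K[x_1,\dots,x_n][1/f]$ and $\psi:K[x_1,\dots,x_n][1/f]\to A$ with $\psi\circ\varphi=\mathrm{id}_A$. Let $H$ and $G$ be finite groups, $H\times G$ their direct product, and $H\wr G=N\rtimes G$ their (regular) wreath product, where $N=\prod_{g\in G}H$ and $G$ acts on $N$ by $({}^{\sigma}x)_g=x_{\sigma^{-1}g}$. **Proposition 4.1.** Suppose that $K(H)$ is stably rational over $K$. Then: 1. $K(G)$ is retract rational over $K$ if and only if $K(H\times G)$ is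 retract rational over $K$; 2. $K(G)$ is retract rational over $K$ if and only if $K(H\wr G)$ is retract rational over $K$. -/

import Mathlib

/-- The action of a group `G` on the polynomial ring `K[x(g) : g ∈ G]` by `K`-automorphisms,
given by `h • x(g) = x(h g)`. -/
noncomputable def regularPolyAction (K : Type*) [Field K] (G : Type*) [Group G] :
    G →* (MvPolynomial G K ≃ₐ[K] MvPolynomial G K) where
  toFun h := MvPolynomial.renameEquiv K (Equiv.mulLeft h)
  map_one' := by
    ext p
    simp
  map_mul' a b := by
    ext p
    simp [MvPolynomial.rename_rename, Function.comp_def]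

/-- The action of `G` on the rational function field `K(x(g) : g ∈ G)` by `K`-automorphisms,
given by `h • x(g) = x(h g)`. -/
noncomputable def regularFieldAction (K : Type*) [Field K] (G : Type*) [Group G] :
    G →* (FractionRing (MvPolynomial G K) ≃ₐ[K] FractionRing (MvPolynomial G K)) :=
  (IsFractionRing.fieldEquivOfAlgEquivHom K (FractionRing (MvPolynomial G K))).comp
    (regularPolyAction K G)

/-- On the variables, the action is `h • x(g) = x(h g)`. -/
theorem regularFieldAction_X (K : Type*) [Field K] (G : Type*) [Group G] (h g : G) :
    regularFieldAction K G h
        (algebraMap (MvPolynomial G K) (FractionRing (MvPolynomial G K)) (MvPolynomial.X g)) =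
      algebraMap (MvPolynomial G K) (FractionRing (MvPolynomial G K))
        (MvPolynomial.X (h * g)) := by
  simp [regularFieldAction, regularPolyAction]

/-- Noether's field `K(G) = K(x(g) : g ∈ G)^G`, the fixed field of `G`. -/
noncomputable def noetherField (K : Type*) [Field K] (G : Type*) [Group G] :
    IntermediateField K (FractionRing (MvPolynomial G K)) :=
  IntermediateField.fixedField (regularFieldAction K G).range

/-- Membership in `K(G)` means being fixed by every element of `G`. -/
theorem mem_noetherField_iff (K : Type*) [Field K] (G : Type*) [Group G]
    (f : FractionRing (MvPolynomial G K)) :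
    f ∈ noetherField K G ↔ ∀ h : G, regularFieldAction K G h f = f := by
  simp [noetherField, IntermediateField.mem_fixedField_iff]

/-- `L` is rational (that is, purely transcendental) over `K`: it is generated as a field over `K`
by a set of algebraically independent elements. -/
def IsRationalExt (K : Type*) [Field K] (L : Type*) [Field L] [Algebra K L] : Prop :=
  ∃ s : Set L, AlgebraicIndependent K ((↑) : s → L) ∧ IntermediateField.adjoin K s = ⊤

/-- `L` is stably rational over `K`: the rational function field `L(w₁, …, wₘ)` is rational
over `K` for some `m`. -/
def IsStablyRationalExt (K : Type*) [Field K] (L : Type*) [Field L] [Algebra K L] : Prop :=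
  ∃ m : ℕ, IsRationalExt K (FractionRing (MvPolynomial (Fin m) L))

/-- `L` is retract rational over `K` (Saltman): there are a `K`-algebra domain `A` with quotient
field `L`, a localized polynomial ring `K[x₁, …, xₙ][1/f]` with `f ≠ 0`, and `K`-algebra
homomorphisms `φ : A → K[x₁, …, xₙ][1/f]` and `ψ : K[x₁, …, xₙ][1/f] → A` with `ψ ∘ φ = id`.
(Then `ψ` is surjective, so `A` is automatically finitely generated over `K`.) -/
def IsRetractRationalExt (K : Type*) [Field K] (L : Type*) [Field L] [Algebra K L] : Prop :=
  ∃ A : Subalgebra K L, IsFractionRing A L ∧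
    ∃ (n : ℕ) (f : MvPolynomial (Fin n) K), f ≠ 0 ∧
      ∃ (φ : A →ₐ[K] Localization.Away f) (ψ : Localization.Away f →ₐ[K] A),
        ψ.comp φ = AlgHom.id K A

/-! Both parts are instances of one statement about a split extension `Γ` of `G` by `N = ∏ j : J,
H`, with `G` permuting `J`. For the direct product `J` is a point, for the wreath product `J = G`.

Everything happens in one rational function field `K(z, x, y)`. `Γ` permutes the `z γ` regularly and
the `y g` regularly through `G`. The `x j p`, with `p` in `H ⊕ Fin m`, form `J` copies of the
variables of `K(H)(w₁, …, wₘ)`: `N` translates the `H`-part of each copy and fixes the `w`-part,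
while `G` permutes the copies.

Two facts are combined. The no-name lemma (`exists_algebraicIndependent_invariants`): if a finite
group acts faithfully on `E` and stabilizes the `E`-span of independent elements `x`, then `E(x)^G`
is purely transcendental over `E^G`. Stability: an infinite field `L` is retract rational if and
only if `L(x₁, …, xₙ)` is. Together (`isRetractRationalExt_invariants_iff`) they allow permuted
variables to be added to, or dropped from, a faithfully permuted family.

Since `Γ` is faithful on `z` and also on `(x, y)`, the field `K(Γ) = K(z)^Γ` may be replaced by
`K(z, x, y)^Γ` and then by `K(x, y)^Γ = (K(x, y)^N)^G`. By stable rationality `K(H)(w)` is generated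
by few elements `u i`; their copies `v (j, i)` satisfy `K(x, y)^N = K(y, v)`
(`adjoin_inf_invariants_eq_of_pi`), and counting shows that `v, y` are independent. As `G` permutes
the `v (j, i)` through `j` and is faithful on `y`, they may be dropped, leaving `K(y)^G = K(G)`. -/

section Invariants

/-! ### Invariants of a finite group: Dedekind independence, traces and Galois descent. -/

variable {K M G : Type*} [Field K] [Field M] [Algebra K M] [Group G]

/-- The fixed field of a group acting by `K`-automorphisms. -/
noncomputable def invariants (ρ : G →* (M ≃ₐ[K] M)) : IntermediateField K M :=
  IntermediateField.fixedField ρ.range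

theorem mem_invariants {ρ : G →* (M ≃ₐ[K] M)} {x : M} :
    x ∈ invariants ρ ↔ ∀ g, ρ g x = x := by
  simp [invariants, IntermediateField.mem_fixedField_iff]

theorem sum_mem_invariants [Fintype G] (ρ : G →* (M ≃ₐ[K] M)) (x : M) :
    ∑ g, ρ g x ∈ invariants ρ := by
  rw [mem_invariants]
  intro h
  rw [map_sum]
  exact Fintype.sum_equiv (Equiv.mulLeft h) _ _ fun g => by simp

/-- The restrictions of the automorphisms `ρ g` to a subfield on which `G` acts faithfully are
linearly independent. -/
theorem linearIndependent_restrict (ρ : G →* (M ≃ₐ[K] M)) (E : IntermediateField K M)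
    (hf : ∀ g, (∀ e ∈ E, ρ g e = e) → g = 1) :
    LinearIndependent M (fun g : G => fun e : E => ρ g e) := by
  have h := linearIndependent_monoidHom E M
  let φ : G → (E →* M) := fun g => ((ρ g : M →* M)).comp (E.val : E →* M)
  have hφ : Function.Injective φ := by
    intro a b hab
    have : ∀ e ∈ E, ρ (b⁻¹ * a) e = e := by
      intro e he
      have h1 : ρ a e = ρ b e := DFunLike.congr_fun hab ⟨e, he⟩
      rw [map_mul, AlgEquiv.mul_apply, h1, ← AlgEquiv.mul_apply, ← map_mul]
      simp
    have := hf _ this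
    rwa [inv_mul_eq_one, eq_comm] at this
  exact h.comp φ hφ

/-- Otherwise the all-ones combination of the restricted automorphisms would vanish, against
Dedekind independence. No assumption on the characteristic is needed. -/
theorem exists_sum_ne_zero [Fintype G] (ρ : G →* (M ≃ₐ[K] M)) (E : IntermediateField K M)
    (hf : ∀ g, (∀ e ∈ E, ρ g e = e) → g = 1) : ∃ a ∈ E, ∑ g, ρ g a ≠ 0 := by
  by_contra! h
  have hl := Fintype.linearIndependent_iff.1 (linearIndependent_restrict ρ E hf) (fun _ => 1)
    (by ext e; simpa using h e e.2) 1
  exact one_ne_zero hl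

/-- An element whose orbit lies in `E` is integral over the invariants of `E`. -/
theorem isIntegral_of_orbit_mem [Finite G] (ρ : G →* (M ≃ₐ[K] M)) {E D : IntermediateField K M}
    -- The monic orbit polynomial of `x` has coefficients that lie in `E` and are invariant, hence
    -- lie in `D`.
    (hD : E ⊓ invariants ρ ≤ D) {x : M} (hx : ∀ g, ρ g x ∈ E) : IsIntegral D x := by
  classical
  have := Fintype.ofFinite G
  let p : Polynomial M := ∏ g : G, (Polynomial.X - Polynomial.C (ρ g x))
  have hmonic : p.Monic := Polynomial.monic_prod_of_monic _ _ fun g _ => Polynomial.monic_X_sub_C _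
  have hE : p ∈ Polynomial.lifts (algebraMap E M) := by
    refine prod_mem fun g _ => ?_
    rw [sub_eq_add_neg, ← Polynomial.C_neg]
    exact add_mem (Polynomial.X_mem_lifts _)
      (Polynomial.C_mem_lifts (algebraMap E M) ⟨-ρ g x, neg_mem (hx g)⟩)
  have hinv : ∀ h, p.map ((ρ h : M ≃ₐ[K] M) : M →+* M) = p := by
    intro h
    simp only [p, Polynomial.map_prod]
    refine Fintype.prod_equiv (Equiv.mulLeft h) _ _ fun g => by simp
  have hD' : p ∈ Polynomial.lifts (algebraMap D M) := by
    rw [Polynomial.lifts_iff_coeff_lifts] at hE ⊢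
    intro n
    obtain ⟨e, he⟩ := hE n
    refine ⟨⟨p.coeff n, hD ⟨?_, ?_⟩⟩, rfl⟩
    · rw [← he]; exact e.2
    · change _ ∈ invariants ρ
      rw [mem_invariants]
      intro g
      conv_rhs => rw [← hinv g]
      simp
  obtain ⟨q, hq, -, hqm⟩ := Polynomial.lifts_and_degree_eq_and_monic hD' hmonic
  refine ⟨q, hqm, ?_⟩
  rw [Polynomial.eval₂_eq_eval_map, hq]
  simp only [p, Polynomial.eval_prod]
  exact Finset.prod_eq_zero (Finset.mem_univ 1) (by simp)

/-- If `B` is generated over invariant elements `D` by a multiplicative set whose traces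
lie in `D`, then `D` is the field of invariants of `B`. -/
theorem inf_invariants_eq_of_sum_mem [Fintype G] (ρ : G →* (M ≃ₐ[K] M))
    {D B : IntermediateField K M} (S : Submonoid M) (hDB : D ≤ B) (hD : D ≤ invariants ρ)
    (hint : ∀ s ∈ S, IsIntegral D s) (htr : ∀ s ∈ S, ∑ g, ρ g s ∈ D)
    (hB : B ≤ IntermediateField.adjoin K ((D : Set M) ∪ S))
    (hf : ∀ g, (∀ e ∈ B, ρ g e = e) → g = 1) :
    B ⊓ invariants ρ = D := by
  have hspan : ∀ b ∈ B, b ∈ Submodule.span D (S : Set M) := by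
    intro b hb
    have h1 : b ∈ (IntermediateField.adjoin D (S : Set M)) := by
      have h2 : IntermediateField.adjoin K ((D : Set M) ∪ S) ≤
          (IntermediateField.adjoin D (S : Set M)).restrictScalars K := by
        rw [IntermediateField.adjoin_le_iff]
        rintro x (hx | hx)
        · exact (IntermediateField.adjoin D (S : Set M)).algebraMap_mem ⟨x, hx⟩
        · exact IntermediateField.subset_adjoin D _ hx
      exact h2 (hB hb)
    -- As `S` is algebraic over `D`, the field `D(S)` is the ring `D[S]`; as `S` is multiplicatively
    -- closed, that ring is its linear span.
    rw [← IntermediateField.mem_toSubalgebra,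
      IntermediateField.adjoin_toSubalgebra_of_isAlgebraic
        (fun s hs => (hint s hs).isAlgebraic), ← Subalgebra.mem_toSubmodule,
      Algebra.adjoin_eq_span, Submonoid.closure_eq] at h1
    exact h1
  have htrB : ∀ b ∈ B, ∑ g, ρ g b ∈ D := by
    intro b hb
    refine Submodule.span_induction (p := fun b _ => ∑ g, ρ g b ∈ D) htr (by simp) ?_ ?_
      (hspan b hb)
    · intro x y _ _ hx hy
      simpa [Finset.sum_add_distrib] using add_mem hx hy
    · intro d x _ hx
      have : ∑ g, ρ g (d • x) = d * ∑ g, ρ g x := by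
        rw [Finset.mul_sum]
        refine Finset.sum_congr rfl fun g _ => ?_
        rw [Algebra.smul_def, map_mul]
        congr 1
        exact mem_invariants.1 (hD d.2) g
      rw [this]
      exact mul_mem d.2 hx
  -- For invariant `b`, the trace of `b * a` is `b` times the trace of `a`; dividing by the nonzero
  -- trace of `a` puts `b` in `D`.
  obtain ⟨a, ha, ha0⟩ := exists_sum_ne_zero ρ B hf
  refine le_antisymm ?_ (le_inf hDB hD)
  rintro b ⟨hb, hbi⟩
  have hbi : ∀ g, ρ g b = b := mem_invariants.1 hbi
  have h1 := htrB (b * a) (mul_mem hb ha)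
  have h2 : ∑ g, ρ g (b * a) = b * ∑ g, ρ g a := by
    simp [Finset.mul_sum, hbi]
  rw [h2] at h1
  have := div_mem h1 (htrB a ha)
  rwa [mul_div_cancel_right₀ _ ha0] at this

/-- Galois descent for a finite-dimensional semilinear representation inside `M`. -/
theorem span_fixed_eq [Finite G] (ρ : G →* (M ≃ₐ[K] M)) (E : IntermediateField K M)
    (hE : ∀ g, ∀ e ∈ E, ρ g e ∈ E) (hf : ∀ g, (∀ e ∈ E, ρ g e = e) → g = 1)
    (V : Submodule E M) (hV : ∀ g, ∀ v ∈ V, ρ g v ∈ V) :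
    Submodule.span E {v | v ∈ V ∧ ∀ g, ρ g v = v} = V := by
  have := Fintype.ofFinite G
  refine le_antisymm (Submodule.span_le.2 fun v hv => hv.1) ?_
  let U : Submodule E V := Submodule.span E {v | ∀ g, ρ g (v : M) = v}
  suffices hU : U = ⊤ by
    have h1 : U.map V.subtype ≤ Submodule.span E {v | v ∈ V ∧ ∀ g, ρ g v = v} := by
      rw [Submodule.map_span, Submodule.span_le]
      rintro _ ⟨v, hv, rfl⟩
      exact Submodule.subset_span ⟨v.2, hv⟩
    rwa [hU, Submodule.map_top, Submodule.range_subtype] at h1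
  by_contra hU
  obtain ⟨f, hf0, hfU⟩ := Submodule.exists_le_ker_of_lt_top U (lt_top_iff_ne_top.2 hU)
  refine hf0 (LinearMap.ext fun v => ?_)
  let r : G → V → V := fun g v => ⟨ρ g v, hV g v v.2⟩
  -- A functional `f` killing the fixed vectors kills the trace of `b • v` for every `b` in `E`.
  -- This is a linear relation among the automorphisms with coefficients `f (g v)`, so Dedekind
  -- gives `f v = 0`.
  have key : ∑ g, ((f (r g v) : E) : M) • (fun e : E => ρ g e) = 0 := by
    ext b
    have hmem : (∑ g, r g (b • v)) ∈ U := by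
      refine Submodule.subset_span fun h => ?_
      have := mem_invariants.1 (sum_mem_invariants ρ ((b • v : V) : M)) h
      simpa [r] using this
    have h0 : f (∑ g, r g (b • v)) = 0 := hfU hmem
    have hr : ∀ g, r g (b • v) = (⟨ρ g b, hE g b b.2⟩ : E) • r g v := by
      intro g
      ext
      simp [r, Algebra.smul_def, IntermediateField.algebraMap_apply]
    simp only [hr, map_sum, map_smul] at h0
    have h1 := congrArg (algebraMap E M) h0
    simp only [map_sum, smul_eq_mul, map_mul, map_zero] at h1
    rw [Finset.sum_apply]
    simp only [Pi.smul_apply, smul_eq_mul, Pi.zero_apply]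
    rw [← h1]
    refine Finset.sum_congr rfl fun g _ => ?_
    rw [mul_comm]
    rfl
  have := Fintype.linearIndependent_iff.1 (linearIndependent_restrict ρ E hf) _ key 1
  have h2 : r 1 v = v := by ext; simp [r]
  rw [h2] at this
  simpa using this

end Invariants

/-! ### Algebraic independence by counting, in the algebraic matroid. -/

section Exchange

/-- A finite family of at most as many elements as an algebraically independent family
algebraic over it is algebraically independent. -/
theorem AlgebraicIndependent.of_card_le_of_isAlgebraic {R M ι κ : Type*} [Field R] [Field M]
    [Algebra R M] [Finite ι] [Finite κ] {x : ι → M} (hx : AlgebraicIndependent R x) (y : κ → M)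
    (hcard : Nat.card κ ≤ Nat.card ι)
    (halg : ∀ i, IsAlgebraic (Algebra.adjoin R (Set.range y)) (x i)) :
    AlgebraicIndependent R y := by
  let m := AlgebraicIndependent.matroid R M
  have h1 : Set.range x ⊆ m.closure (Set.range y) := by
    rintro _ ⟨i, rfl⟩
    rw [AlgebraicIndependent.matroid_closure_eq]
    exact halg i
  have hxi : m.Indep (Set.range x) := by
    rw [AlgebraicIndependent.matroid_indep_iff]
    exact hx.coe_range
  have hcx : (Set.range x).encard = Nat.card ι := by
    rw [← Set.image_univ, hx.injective.encard_image, Set.encard_univ, ENat.card_eq_coe_natCard]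
  have hcy : (Set.range y).encard ≤ Nat.card κ := by
    rw [← Set.image_univ]
    refine (Set.encard_image_le _ _).trans ?_
    rw [Set.encard_univ, ENat.card_eq_coe_natCard]
  -- The closure of `y` contains the independent set `x`, so `y` has rank at least `card ι`, while
  -- it has at most `card κ ≤ card ι` elements. Equality forces both independence of the range and
  -- injectivity.
  have h2 : (Nat.card ι : ℕ∞) ≤ m.eRk (Set.range y) := by
    rw [← hcx, ← hxi.eRk_eq_encard, ← m.eRk_closure_eq (Set.range y)]
    exact m.eRk_mono h1
  have h3 := m.eRk_le_encard (Set.range y)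
  have hcard' : (Nat.card κ : ℕ∞) ≤ Nat.card ι := by exact_mod_cast hcard
  have hyi : m.Indep (Set.range y) := by
    rw [Matroid.indep_iff_eRk_eq_encard_of_finite (Set.finite_range y)]
    exact le_antisymm h3 (hcy.trans (hcard'.trans h2))
  have hinj : Function.Injective y := by
    have h4 : (Set.range y).encard = Nat.card κ :=
      le_antisymm hcy (hcard'.trans (h2.trans h3))
    rw [← Set.injOn_univ]
    refine Set.finite_univ.injOn_of_encard_image_eq ?_
    rw [Set.image_univ, h4, Set.encard_univ, ENat.card_eq_coe_natCard]
  rw [AlgebraicIndependent.matroid_indep_iff] at hyi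
  exact (algebraicIndependent_subtype_range hinj).1 hyi

end Exchange

/-! ### The no-name lemma. -/

section NoName

variable {K M G : Type*} [Field K] [Field M] [Algebra K M] [Group G]

theorem AlgebraicIndependent.of_le {ι : Type*} {A B : IntermediateField K M} (h : A ≤ B)
    {z : ι → M} (hz : AlgebraicIndependent B z) : AlgebraicIndependent A z := by
  let := (IntermediateField.inclusion h).toRingHom.toAlgebra
  have : IsScalarTower A B M := IsScalarTower.of_algebraMap_eq fun _ => rfl
  exact hz.restrictScalars (IntermediateField.inclusion h).injective

/-- The no-name lemma: algebraically independent elements over `E` spanning a `G`-stable `E`-linear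
subspace may be replaced by invariants. -/
theorem exists_algebraicIndependent_invariants {ι : Type*} [Finite G] [Finite ι]
    (ρ : G →* (M ≃ₐ[K] M)) (E : IntermediateField K M)
    (hE : ∀ g, ∀ e ∈ E, ρ g e ∈ E) (hf : ∀ g, (∀ e ∈ E, ρ g e = e) → g = 1)
    (x : ι → M) (hx : AlgebraicIndependent E x)
    (hρ : ∀ g i, ρ g (x i) ∈ Submodule.span E (Set.range x)) :
    ∃ z : ι → M, AlgebraicIndependent (E ⊓ invariants ρ : IntermediateField K M) z ∧
      IntermediateField.adjoin K (((E ⊓ invariants ρ : IntermediateField K M) : Set M) ∪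
        Set.range z) =
      IntermediateField.adjoin K ((E : Set M) ∪ Set.range x) ⊓ invariants ρ := by
  have := Fintype.ofFinite G
  have := Fintype.ofFinite ι
  set V := Submodule.span E (Set.range x) with hVdef
  have hV : ∀ g, ∀ v ∈ V, ρ g v ∈ V := by
    intro g v hv
    refine Submodule.span_induction (p := fun v _ => ρ g v ∈ V) ?_ (by simp) ?_ ?_ hv
    · rintro _ ⟨i, rfl⟩
      exact hρ g i
    · intro a b _ _ ha hb
      simpa using add_mem ha hb
    · intro e v _ hv
      rw [Algebra.smul_def, map_mul]
      exact V.smul_mem ⟨ρ g e, hE g e e.2⟩ hv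
  -- Descent yields an `E`-basis of `V` made of invariants; it has as many elements as `x`.
  have hspan := span_fixed_eq ρ E hE hf V hV
  obtain ⟨b, hbsub, hbspan, hbli⟩ :=
    exists_linearIndependent E {v | v ∈ V ∧ ∀ g, ρ g v = v}
  rw [hspan] at hbspan
  have hcard : Nonempty (ι ≃ b) := by
    let B1 := Module.Basis.span hx.linearIndependent
    let B2 := Module.Basis.span hbli
    rw [Subtype.range_coe, hbspan] at B2
    exact ⟨B1.indexEquiv B2⟩
  obtain ⟨e⟩ := hcard
  let z : ι → M := fun i => e i
  have hzr : Set.range z = b := by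
    ext v
    constructor
    · rintro ⟨i, rfl⟩
      exact (e i).2
    · intro hv
      exact ⟨e.symm ⟨v, hv⟩, by simp [z]⟩
  have hzV : ∀ i, z i ∈ V := fun i => (hbsub (e i).2).1
  have hzinv : ∀ i, z i ∈ invariants ρ := fun i => mem_invariants.2 (hbsub (e i).2).2
  have hxz : ∀ i, x i ∈ Submodule.span E (Set.range z) := by
    intro i
    rw [hzr, hbspan]
    exact Submodule.subset_span ⟨i, rfl⟩
  have hzE : AlgebraicIndependent E z := by
    refine hx.of_card_le_of_isAlgebraic z le_rfl fun i => ?_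
    have : x i ∈ Algebra.adjoin E (Set.range z) := Algebra.span_le_adjoin E _ (hxz i)
    exact isAlgebraic_algebraMap (⟨x i, this⟩ : Algebra.adjoin E (Set.range z))
  refine ⟨z, hzE.of_le inf_le_left, ?_⟩
  have hsp : ∀ {s : Set M} {F : IntermediateField K M}, E ≤ F → s ⊆ F →
      ∀ v ∈ Submodule.span E s, v ∈ F := by
    intro s F hEF hs v hv
    refine Submodule.span_induction (p := fun v _ => v ∈ F) (fun v hv => hs hv) (zero_mem _)
      (fun _ _ _ _ => add_mem) (fun a v _ hv => ?_) hv
    rw [Algebra.smul_def]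
    exact mul_mem (hEF a.2) hv
  have hEB : E ≤ IntermediateField.adjoin K ((E : Set M) ∪ Set.range x) := fun a ha =>
    IntermediateField.subset_adjoin K _ (Or.inl ha)
  symm
  -- The multiplicative set is `E` itself: `E(x)` is generated over `E^G(z)` by `E`, and traces of
  -- elements of `E` lie in `E^G`.
  refine inf_invariants_eq_of_sum_mem ρ E.toSubalgebra.toSubsemiring.toSubmonoid ?_ ?_ ?_ ?_ ?_ ?_
  · rw [IntermediateField.adjoin_le_iff]
    rintro v (hv | ⟨i, rfl⟩)
    · exact hEB hv.1
    · exact hsp hEB (fun v hv => IntermediateField.subset_adjoin K _ (Or.inr hv)) _ (hzV i)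
  · rw [IntermediateField.adjoin_le_iff]
    rintro v (hv | ⟨i, rfl⟩)
    · exact hv.2
    · exact hzinv i
  · intro s hs
    exact isIntegral_of_orbit_mem (E := E) ρ
      (fun a ha => IntermediateField.subset_adjoin K _ (Or.inl ha)) fun g => hE g s hs
  · intro s hs
    exact IntermediateField.subset_adjoin K _
      (Or.inl ⟨sum_mem fun g _ => hE g s hs, sum_mem_invariants ρ s⟩)
  · have hE' : E ≤ IntermediateField.adjoin K (((IntermediateField.adjoin K
        (((E ⊓ invariants ρ : IntermediateField K M) : Set M) ∪ Set.range z) :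
          IntermediateField K M) : Set M) ∪
          (E.toSubalgebra.toSubsemiring.toSubmonoid : Set M)) := fun a ha =>
      IntermediateField.subset_adjoin K _ (Or.inr ha)
    rw [IntermediateField.adjoin_le_iff]
    rintro v (hv | ⟨i, rfl⟩)
    · exact hE' hv
    · refine hsp hE' ?_ _ (hxz i)
      intro v hv
      exact IntermediateField.subset_adjoin K _
        (Or.inl (IntermediateField.subset_adjoin K _ (Or.inr hv)))
  · intro g hg
    exact hf g fun a ha => hg a (hEB ha)

/-- The invariants of a field containing a transcendental element are infinite. -/
theorem infinite_inf_invariants [Finite G] (ρ : G →* (M ≃ₐ[K] M)) (E : IntermediateField K M)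
    (hE : ∀ g, ∀ e ∈ E, ρ g e ∈ E) {t : M} (ht : t ∈ E) (htr : Transcendental K t) :
    Infinite (E ⊓ invariants ρ : IntermediateField K M) := by
  by_contra h
  rw [not_infinite_iff_finite] at h
  have h1 : IsIntegral (E ⊓ invariants ρ : IntermediateField K M) t :=
    isIntegral_of_orbit_mem ρ (le_refl _) fun g => hE g t ht
  have : Module.Finite K (E ⊓ invariants ρ : IntermediateField K M) := Module.Finite.of_finite
  exact htr (isIntegral_trans (R := K) _ h1).isAlgebraic

end NoName

/-! ### Retracts of localized polynomial rings: localization and added variables. -/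

section RetractAlgebra

/-- Phrased with `IsLocalization.Away` so as to cover both `Localization.Away` and localizations
realized inside a field. -/
theorem exists_away_lift {K R S P : Type*} [CommRing K] [CommRing R] [CommRing S] [CommRing P]
    [Algebra K R] [Algebra K S] [Algebra K P] [Algebra R S] [IsScalarTower K R S] (f : R)
    [IsLocalization.Away f S] (α : R →ₐ[K] P) (h : IsUnit (α f)) :
    ∃ l : S →ₐ[K] P, ∀ q, l (algebraMap R S q) = α q :=
  ⟨IsLocalization.Away.liftAlgHom f (f := α) h, fun q => IsLocalization.Away.lift_eq f h q⟩

theorem away_algHom_congr {K R S P : Type*} [CommRing K] [CommRing R] [CommRing S] [CommRing P]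
    [Algebra K R] [Algebra K S] [Algebra K P] [Algebra R S] [IsScalarTower K R S] (f : R)
    [IsLocalization.Away f S] {l m : S →ₐ[K] P}
    (h : ∀ q, l (algebraMap R S q) = m (algebraMap R S q)) (s : S) : l s = m s :=
  RingHom.congr_fun (IsLocalization.ringHom_ext (Submonoid.powers f)
    (j := (l : S →+* P)) (k := (m : S →+* P)) (RingHom.ext h)) s

/-- The `K`-algebra `A` is a retract of a localized polynomial ring `K[x₁, …, xₙ][1/f]`. -/
def IsRetractAlgebra (K : Type*) [Field K] (A : Type*) [CommRing A] [Algebra K A] : Prop :=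
  ∃ (n : ℕ) (f : MvPolynomial (Fin n) K), f ≠ 0 ∧
    ∃ (φ : A →ₐ[K] Localization.Away f) (ψ : Localization.Away f →ₐ[K] A),
      ψ.comp φ = AlgHom.id K A

namespace IsRetractAlgebra

variable {K A B : Type*} [Field K] [CommRing A] [Algebra K A] [CommRing B] [Algebra K B]

theorem of_retract (hA : IsRetractAlgebra K A) (i : B →ₐ[K] A) (r : A →ₐ[K] B)
    (h : ∀ b, r (i b) = b) : IsRetractAlgebra K B := by
  obtain ⟨n, f, hf, φ, ψ, hψ⟩ := hA
  refine ⟨n, f, hf, φ.comp i, r.comp ψ, ?_⟩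
  ext b
  have h1 := DFunLike.congr_fun hψ (i b)
  simp only [AlgHom.comp_apply, AlgHom.id_apply] at h1 ⊢
  rw [h1, h]

theorem of_algEquiv (hA : IsRetractAlgebra K A) (e : A ≃ₐ[K] B) : IsRetractAlgebra K B :=
  hA.of_retract e.symm.toAlgHom e.toAlgHom (by simp)

/-- Any finite type of variables may be used. -/
theorem of_finite {σ : Type*} [Finite σ] {f : MvPolynomial σ K} (hf : f ≠ 0)
    (φ : A →ₐ[K] Localization.Away f) (ψ : Localization.Away f →ₐ[K] A)
    (h : ∀ a, ψ (φ a) = a) : IsRetractAlgebra K A := by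
  let e := MvPolynomial.renameEquiv K (Finite.equivFin σ)
  refine of_retract (A := Localization.Away f) ⟨Nat.card σ, e f, by simpa using hf, ?_⟩ φ ψ h
  obtain ⟨l, hl⟩ := exists_away_lift (S := Localization.Away f) f
    ((Algebra.algHom K _ (Localization.Away (e f))).comp e.toAlgHom)
    (IsLocalization.Away.algebraMap_isUnit (e f))
  obtain ⟨m, hm⟩ := exists_away_lift (S := Localization.Away (e f)) (e f)
    ((Algebra.algHom K _ (Localization.Away f)).comp e.symm.toAlgHom) (by
      have := IsLocalization.Away.algebraMap_isUnit (S := Localization.Away f) f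
      have h1 : e.symm (e f) = f := e.symm_apply_apply f
      change IsUnit (algebraMap _ _ (e.symm (e f)))
      rwa [h1])
  refine ⟨l, m, AlgHom.ext fun s => ?_⟩
  refine away_algHom_congr f (l := m.comp l) (m := AlgHom.id K _) (fun q => ?_) s
  simp only [AlgHom.comp_apply, hl]
  refine (hm (e q)).trans ?_
  exact congrArg (algebraMap _ _) (e.symm_apply_apply q)

theorem finiteType (hA : IsRetractAlgebra K A) : Algebra.FiniteType K A := by
  obtain ⟨n, f, hf, φ, ψ, hψ⟩ := hA
  have : Algebra.FiniteType K (Localization.Away f) := inferInstance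
  exact this.of_surjective ψ fun a => ⟨φ a, DFunLike.congr_fun hψ a⟩

/-- A localization at one nonzero element of a retract algebra is a retract algebra. -/
theorem away (hA : IsRetractAlgebra K A) {a : A} (ha : a ≠ 0) [Algebra A B] [IsScalarTower K A B]
    [IsLocalization.Away a B] : IsRetractAlgebra K B := by
  obtain ⟨n, f, hf, φ, ψ, hψ⟩ := hA
  have hψ' : ∀ x, ψ (φ x) = x := DFunLike.congr_fun hψ
  -- Clear denominators: `φ a * f ^ k = p`. Then `A[1/a]` is a retract of the polynomial ring with
  -- `f * p` inverted, since `φ a` becomes a unit there.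
  obtain ⟨k, p, hp⟩ := IsLocalization.Away.surj f (φ a)
  have hfu : IsUnit (algebraMap _ (Localization.Away f) f) :=
    IsLocalization.Away.algebraMap_isUnit f
  have hp0 : p ≠ 0 := by
    rintro rfl
    rw [map_zero, (hfu.pow k).mul_left_eq_zero] at hp
    exact ha (by rw [← hψ' a, hp, map_zero])
  let T := Localization.Away (f * p)
  have hfp : IsUnit (algebraMap _ T (f * p)) := IsLocalization.Away.algebraMap_isUnit (f * p)
  rw [map_mul] at hfp
  have hpT : IsUnit (algebraMap _ T p) := isUnit_of_mul_isUnit_right hfp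
  obtain ⟨j, hj⟩ := exists_away_lift (S := Localization.Away f) f (Algebra.algHom K _ T)
    (isUnit_of_mul_isUnit_left hfp)
  have hj : ∀ q, j (algebraMap _ _ q) = algebraMap _ T q := hj
  have haT : IsUnit ((j.comp φ) a) := by
    have := congrArg j hp
    rw [map_mul, hj] at this
    rw [← this] at hpT
    exact isUnit_of_mul_isUnit_left hpT
  let α : MvPolynomial (Fin n) K →ₐ[K] B :=
    ((Algebra.algHom K A B).comp ψ).comp (Algebra.algHom K _ _)
  have hα : ∀ q, α q = algebraMap A B (ψ (algebraMap _ _ q)) := fun q => rfl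
  -- Applying `ψ` to `φ a * f ^ k = p` gives `ψ p = a * ψ f ^ k`, a unit once `a` is inverted.
  have hαu : IsUnit (α (f * p)) := by
    rw [map_mul, hα, hα, ← hp, map_mul, hψ', map_mul, map_pow, map_pow]
    have h1 : IsUnit (algebraMap A B (ψ (algebraMap _ _ f))) := (hfu.map ψ).map _
    exact h1.mul ((IsLocalization.Away.algebraMap_isUnit a).mul (h1.pow k))
  obtain ⟨ψ', hψ1⟩ := exists_away_lift (S := T) (f * p) α hαu
  obtain ⟨φ', hφ1⟩ := exists_away_lift (S := B) a (j.comp φ) haT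
  have hψj : ∀ s, ψ' (j s) = algebraMap A B (ψ s) :=
    away_algHom_congr f (l := ψ'.comp j) (m := (Algebra.algHom K A B).comp ψ) fun q => by
      simp only [AlgHom.comp_apply, hj, hψ1]
      rfl
  refine of_finite (σ := Fin n) (f := f * p) (mul_ne_zero hf hp0) φ' ψ' ?_
  refine away_algHom_congr a (l := ψ'.comp φ') (m := AlgHom.id K B) fun x => ?_
  simp only [AlgHom.comp_apply, hφ1, hψj, hψ', AlgHom.id_apply]

/-- The same extra variables are adjoined to `A` and to the polynomial ring, still inverting only
`f`. -/
theorem mvPolynomial (hA : IsRetractAlgebra K A) (σ : Type*) [Finite σ] :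
    IsRetractAlgebra K (MvPolynomial σ A) := by
  obtain ⟨n, f, hf, φ, ψ, hψ⟩ := hA
  have hψ' : ∀ x, ψ (φ x) = x := DFunLike.congr_fun hψ
  let ren : MvPolynomial (Fin n) K →ₐ[K] MvPolynomial (σ ⊕ Fin n) K := MvPolynomial.rename Sum.inr
  have hg : ren f ≠ 0 := fun h => hf
    (MvPolynomial.rename_injective Sum.inr Sum.inr_injective (h.trans (map_zero ren).symm))
  let T := Localization.Away (ren f)
  obtain ⟨j, hj⟩ := exists_away_lift (S := Localization.Away f) f
    ((Algebra.algHom K _ T).comp ren) (IsLocalization.Away.algebraMap_isUnit (ren f))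
  have hj : ∀ q, j (algebraMap _ _ q) = algebraMap _ T (ren q) := hj
  let φ' : MvPolynomial σ A →ₐ[K] T :=
    MvPolynomial.aevalTower (j.comp φ) fun i =>
      algebraMap (MvPolynomial (σ ⊕ Fin n) K) T (MvPolynomial.X (Sum.inl i))
  let α : MvPolynomial (σ ⊕ Fin n) K →ₐ[K] MvPolynomial σ A :=
    MvPolynomial.aeval (Sum.elim (MvPolynomial.X : σ → MvPolynomial σ A) fun i =>
      algebraMap A (MvPolynomial σ A) (ψ (algebraMap (MvPolynomial (Fin n) K) _ (MvPolynomial.X i))))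
  have hα : ∀ q, α (ren q) = algebraMap A (MvPolynomial σ A) (ψ (algebraMap _ _ q)) := by
    refine fun q => DFunLike.congr_fun (f := α.comp ren)
      (g := ((Algebra.algHom K A (MvPolynomial σ A)).comp ψ).comp
        (Algebra.algHom K _ (Localization.Away f))) ?_ q
    refine MvPolynomial.algHom_ext fun i => ?_
    simp only [AlgHom.comp_apply, ren, MvPolynomial.rename_X, α, MvPolynomial.aeval_X,
      Sum.elim_inr]
    rfl
  obtain ⟨ψ', hψ1⟩ := exists_away_lift (S := T) (ren f) α (by
    rw [hα]
    exact ((IsLocalization.Away.algebraMap_isUnit f).map ψ).map _)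
  have hψj : ∀ s, ψ' (j s) = algebraMap A (MvPolynomial σ A) (ψ s) :=
    away_algHom_congr f (l := ψ'.comp j) (m := (Algebra.algHom K A _).comp ψ) fun q => by
      simp only [AlgHom.comp_apply, hj, hψ1, hα]
      rfl
  refine of_finite hg φ' ψ' fun p => ?_
  induction p using MvPolynomial.induction_on with
  | C a =>
    simp only [φ', MvPolynomial.aevalTower_C, AlgHom.comp_apply, hψj, hψ']
    rfl
  | add p q hp hq => rw [map_add, map_add, hp, hq]
  | mul_X p i hp =>
    rw [map_mul, map_mul, hp]
    simp [φ', hψ1, α]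

end IsRetractAlgebra

end RetractAlgebra

/-! ### Subalgebras with the same fraction field, and their localizations inside it. -/

section Fractions

variable {K M : Type*} [Field K] [Field M] [Algebra K M]

theorem isFractionRing_iff_adjoin_eq_top (A : Subalgebra K M) :
    IsFractionRing A M ↔ IntermediateField.adjoin K (A : Set M) = ⊤ := by
  constructor
  · intro h
    refine eq_top_iff.2 fun x _ => ?_
    obtain ⟨a, b, -, rfl⟩ := IsFractionRing.div_surjective (A := A) x
    exact div_mem (IntermediateField.subset_adjoin K _ a.2)
      (IntermediateField.subset_adjoin K _ b.2)
  · intro h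
    refine IsFractionRing.of_field A M fun x => ?_
    have hx : x ∈ IntermediateField.adjoin K (A : Set M) := h ▸ IntermediateField.mem_top
    obtain ⟨r, hr, s, hs, rfl⟩ := IntermediateField.mem_adjoin_iff_div.1 hx
    rw [Algebra.adjoin_eq] at hr hs
    exact ⟨⟨r, hr⟩, ⟨s, hs⟩, rfl⟩

theorem isRetractRationalExt_iff :
    IsRetractRationalExt K M ↔ ∃ A : Subalgebra K M,
      IntermediateField.adjoin K (A : Set M) = ⊤ ∧ IsRetractAlgebra K A := by
  simp only [IsRetractRationalExt, isFractionRing_iff_adjoin_eq_top]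
  rfl

/-- The localization `A[1/a]` inside the ambient field. -/
def Subalgebra.awayIn (A : Subalgebra K M) (a : A) : Subalgebra K M where
  carrier := {m | ∃ n : ℕ, m * (a : M) ^ n ∈ A}
  mul_mem' := by
    rintro x y ⟨k, hk⟩ ⟨l, hl⟩
    refine ⟨k + l, ?_⟩
    have := mul_mem hk hl
    rwa [mul_mul_mul_comm, ← pow_add] at this
  add_mem' := by
    rintro x y ⟨k, hk⟩ ⟨l, hl⟩
    refine ⟨k + l, ?_⟩
    have := add_mem (mul_mem hk (pow_mem a.2 l)) (mul_mem hl (pow_mem a.2 k))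
    rwa [mul_assoc, ← pow_add, mul_assoc, ← pow_add, add_comm l k, ← add_mul] at this
  algebraMap_mem' r := ⟨0, by simp⟩

variable {A C : Subalgebra K M}

theorem Subalgebra.le_awayIn (a : A) : A ≤ A.awayIn a := fun m hm => ⟨0, by simpa using hm⟩

theorem Subalgebra.inv_mem_awayIn {a : A} (ha : a ≠ 0) : (a : M)⁻¹ ∈ A.awayIn a :=
  ⟨1, by
    have : (a : M) ≠ 0 := by simpa using ha
    simp [this]⟩

theorem Subalgebra.awayIn_le {a : A} (ha : a ≠ 0) (h : A ≤ C) (h' : (a : M)⁻¹ ∈ C) :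
    A.awayIn a ≤ C := by
  rintro m ⟨n, hn⟩
  have h0 : (a : M) ≠ 0 := by simpa using ha
  have := mul_mem (h hn) (pow_mem h' n)
  rwa [mul_assoc, ← mul_pow, mul_inv_cancel₀ h0, one_pow, mul_one] at this

theorem Subalgebra.isLocalization_away_awayIn {a : A} (ha : a ≠ 0) :
    letI := (Subalgebra.inclusion (A.le_awayIn a)).toRingHom.toAlgebra
    IsLocalization.Away a (A.awayIn a) := by
  let := (Subalgebra.inclusion (A.le_awayIn a)).toRingHom.toAlgebra
  have h0 : (a : M) ≠ 0 := by simpa using ha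
  refine ⟨⟨?_, ?_, ?_⟩⟩
  · rintro ⟨_, n, rfl⟩
    simp only [map_pow]
    refine IsUnit.pow n ?_
    refine IsUnit.of_mul_eq_one ⟨(a : M)⁻¹, Subalgebra.inv_mem_awayIn ha⟩ ?_
    ext
    exact mul_inv_cancel₀ h0
  · rintro ⟨m, n, hn⟩
    exact ⟨(⟨_, hn⟩, ⟨_, n, rfl⟩), by ext; rfl⟩
  · intro x y hxy
    refine ⟨1, ?_⟩
    have : (x : M) = y := congrArg (fun m : A.awayIn a => (m : M)) hxy
    rw [Subtype.ext this]

/-- A common denominator in `C` for finitely many generators of `A` suffices. -/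
theorem exists_le_awayIn (hA : A.FG) (hC : IntermediateField.adjoin K (C : Set M) = ⊤) :
    ∃ c : C, c ≠ 0 ∧ A ≤ C.awayIn c := by
  obtain ⟨s, rfl⟩ := hA
  have := (isFractionRing_iff_adjoin_eq_top C).2 hC
  obtain ⟨⟨c, hc⟩, h⟩ := IsLocalization.exist_integer_multiples_of_finset (nonZeroDivisors C) s
  refine ⟨c, nonZeroDivisors.ne_zero hc, Algebra.adjoin_le fun x hx => ⟨1, ?_⟩⟩
  obtain ⟨y, hy⟩ := h x hx
  have : (y : M) = c * x := hy
  rw [pow_one, mul_comm, ← this]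
  exact y.2

/-- Finitely generated algebras with the same fraction field become equal after inverting one
element of each. -/
theorem exists_awayIn_eq_awayIn (hA : A.FG) (hC : C.FG)
    (hA' : IntermediateField.adjoin K (A : Set M) = ⊤)
    (hC' : IntermediateField.adjoin K (C : Set M) = ⊤) :
    ∃ (a : A) (c : C), a ≠ 0 ∧ c ≠ 0 ∧ A.awayIn a = C.awayIn c := by
  obtain ⟨c₀, hc₀, hAC⟩ := exists_le_awayIn hA hC'
  obtain ⟨a₀, ha₀, hCA⟩ := exists_le_awayIn hC hA'
  have hc₀' : (c₀ : M) ≠ 0 := by simpa using hc₀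
  have ha₀' : (a₀ : M) ≠ 0 := by simpa using ha₀
  -- With `u = a₀ * c₀ ^ k` in `C`, inverting `c₀ * u` inverts both `c₀` and `a₀`. With `v = c₀ * u
  -- * a₀ ^ l` in `A`, inverting `a₀ * v` inverts both `a₀` and `c₀ * u`. Hence the two
  -- localizations contain each other.
  obtain ⟨k, hk⟩ := hAC a₀.2
  let u : C := ⟨_, hk⟩
  have hu : (u : M) = a₀ * c₀ ^ k := rfl
  have hu' : (u : M) ≠ 0 := by rw [hu]; positivity
  have hu0 : u ≠ 0 := fun h => hu' (by rw [h]; rfl)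
  obtain ⟨l, hl⟩ := hCA (c₀ * u).2
  let v : A := ⟨_, hl⟩
  have hv : (v : M) = c₀ * u * a₀ ^ l := rfl
  have hv' : (v : M) ≠ 0 := by rw [hv]; positivity
  have hv0 : v ≠ 0 := fun h => hv' (by rw [h]; rfl)
  refine ⟨a₀ * v, c₀ * u, mul_ne_zero ha₀ hv0, mul_ne_zero hc₀ hu0, le_antisymm ?_ ?_⟩
  · set D := C.awayIn (c₀ * u)
    have hCD : C ≤ D := C.le_awayIn _
    have hcu : ((c₀ : M) * u)⁻¹ ∈ D := Subalgebra.inv_mem_awayIn (mul_ne_zero hc₀ hu0)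
    have h1 : C.awayIn c₀ ≤ D := Subalgebra.awayIn_le hc₀ hCD (by
      have : (c₀ : M)⁻¹ = u * ((c₀ : M) * u)⁻¹ := by field_simp
      rw [this]
      exact mul_mem (hCD u.2) hcu)
    have h2 : (a₀ : M)⁻¹ ∈ D := by
      have : (a₀ : M)⁻¹ = c₀ ^ k * c₀ * ((c₀ : M) * u)⁻¹ := by
        rw [hu]; field_simp
      rw [this]
      exact mul_mem (mul_mem (pow_mem (hCD c₀.2) _) (hCD c₀.2)) hcu
    refine Subalgebra.awayIn_le (mul_ne_zero ha₀ hv0) (hAC.trans h1) ?_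
    have : ((a₀ * v : A) : M)⁻¹ = (a₀ : M)⁻¹ * (((c₀ : M) * u)⁻¹ * (a₀ : M)⁻¹ ^ l) := by
      push_cast
      rw [hv, mul_inv, mul_inv, inv_pow]
    rw [this]
    exact mul_mem h2 (mul_mem hcu (pow_mem h2 l))
  · set D := A.awayIn (a₀ * v)
    have hAD : A ≤ D := A.le_awayIn _
    have hav : ((a₀ : M) * v)⁻¹ ∈ D := Subalgebra.inv_mem_awayIn (mul_ne_zero ha₀ hv0)
    have h1 : A.awayIn a₀ ≤ D := Subalgebra.awayIn_le ha₀ hAD (by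
      have : (a₀ : M)⁻¹ = v * ((a₀ : M) * v)⁻¹ := by field_simp
      rw [this]
      exact mul_mem (hAD v.2) hav)
    refine Subalgebra.awayIn_le (mul_ne_zero hc₀ hu0) (hCA.trans h1) ?_
    have : ((c₀ * u : C) : M)⁻¹ = a₀ ^ l * a₀ * ((a₀ : M) * v)⁻¹ := by
      push_cast
      rw [hv]; field_simp
    rw [this]
    exact mul_mem (mul_mem (pow_mem (hAD a₀.2) _) (hAD a₀.2)) hav

end Fractions

/-! ### Retract rationality under purely transcendental extensions. -/

section Stability

variable {K L M σ : Type*} [Field K] [Field L] [Field M] [Algebra K L] [Algebra K M] [Algebra L M]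
  [IsScalarTower K L M] {x : σ → M}

/-- The evaluation of polynomials with coefficients in a subalgebra of `L`. -/
noncomputable def evalAt (R : Subalgebra K L) (x : σ → M) : MvPolynomial σ R →ₐ[K] M :=
  MvPolynomial.aevalTower ((IsScalarTower.toAlgHom K L M).comp R.val) x

theorem evalAt_eq (R : Subalgebra K L) (x : σ → M) (p : MvPolynomial σ R) :
    evalAt R x p = MvPolynomial.aeval x (MvPolynomial.map (algebraMap R L) p) := by
  induction p using MvPolynomial.induction_on with
  | C a => simp [evalAt]
  | add p q hp hq => rw [map_add, map_add, map_add, hp, hq]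
  | mul_X p i hp => rw [map_mul, map_mul, map_mul, hp]; simp [evalAt]

theorem evalAt_injective (R : Subalgebra K L) (hx : AlgebraicIndependent L x) :
    Function.Injective (evalAt R x) := by
  intro p q h
  rw [evalAt_eq, evalAt_eq] at h
  exact MvPolynomial.map_injective _ (FaithfulSMul.algebraMap_injective R L) (hx h)

/-- If `A` is a retract algebra with fraction field `L`, then `A[x]` is one with fraction field
`L(x)`. -/
theorem IsRetractRationalExt.of_purelyTranscendental [Finite σ] (hx : AlgebraicIndependent L x)
    (hM : IntermediateField.adjoin L (Set.range x) = ⊤) (h : IsRetractRationalExt K L) :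
    IsRetractRationalExt K M := by
  rw [isRetractRationalExt_iff] at h ⊢
  obtain ⟨A, hA, hret⟩ := h
  refine ⟨(evalAt A x).range, ?_, (hret.mvPolynomial σ).of_algEquiv
    (AlgEquiv.ofInjective _ (evalAt_injective A hx))⟩
  have h1 : ∀ l : L, algebraMap L M l ∈
      IntermediateField.adjoin K ((evalAt A x).range : Set M) := by
    have : (⊤ : IntermediateField K L) ≤ (IntermediateField.adjoin K
        ((evalAt A x).range : Set M)).comap (IsScalarTower.toAlgHom K L M) := by
      rw [← hA, IntermediateField.adjoin_le_iff]
      intro a ha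
      refine IntermediateField.subset_adjoin K _ ⟨MvPolynomial.C ⟨a, ha⟩, ?_⟩
      simp [evalAt]
    exact fun l => this IntermediateField.mem_top
  let F : IntermediateField L M :=
    { (IntermediateField.adjoin K ((evalAt A x).range : Set M)).toSubfield with
      algebraMap_mem' := h1 }
  have hF : F = ⊤ := by
    rw [eq_top_iff, ← hM, IntermediateField.adjoin_le_iff]
    rintro _ ⟨i, rfl⟩
    exact IntermediateField.subset_adjoin K _ ⟨MvPolynomial.X i, by simp [evalAt]⟩
  refine eq_top_iff.2 fun m _ => ?_
  have : m ∈ F := hF ▸ IntermediateField.mem_top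
  exact this

/-- After inverting one element of each, the given model of `L(x)` agrees with `R[x]` for some
finitely generated `R` in `L`. Specializing `x` to a point of `R` where the inverted polynomial is
nonzero makes a localization of `R` a retract of a localization of that model. Infinitude of `L`
supplies the point. -/
theorem IsRetractRationalExt.of_algebraicIndependent_adjoin_eq_top [Finite σ] [Infinite L]
    (hx : AlgebraicIndependent L x)
    (hM : IntermediateField.adjoin L (Set.range x) = ⊤) (h : IsRetractRationalExt K M) :
    IsRetractRationalExt K L := by
  classical
  rw [isRetractRationalExt_iff] at h ⊢
  obtain ⟨A, hA, hret⟩ := h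
  have hAfg : A.FG := A.fg_iff_finiteType.2 hret.finiteType
  have hfrac : ∀ m : M, ∃ P Q : MvPolynomial σ L,
      m = MvPolynomial.aeval x P / MvPolynomial.aeval x Q := fun m =>
    (IntermediateField.mem_adjoin_range_iff L x m).1 (hM ▸ IntermediateField.mem_top)
  choose P Q hPQ using hfrac
  obtain ⟨s, hs⟩ := hAfg
  -- All coefficients needed to write the generators of `A` as quotients of polynomials in `x`.
  let t : Finset L := s.biUnion fun m => (P m).coeffs ∪ (Q m).coeffs
  let R : Subalgebra K L := Algebra.adjoin K t
  have hRft : Algebra.FiniteType K R := R.fg_iff_finiteType.1 (Subalgebra.fg_adjoin_finset t)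
  let C : Subalgebra K M := (evalAt R x).range
  have hCfg : C.FG := by
    rw [Subalgebra.fg_iff_finiteType]
    exact Algebra.FiniteType.of_surjective (evalAt R x).rangeRestrict
      (evalAt R x).rangeRestrict_surjective
  have hlift : ∀ p : MvPolynomial σ L, p.coeffs ⊆ t → MvPolynomial.aeval x p ∈ C := by
    intro p hp
    have : p ∈ Set.range (MvPolynomial.map (σ := σ) (algebraMap R L)) := by
      rw [MvPolynomial.mem_range_map_iff_coeffs_subset]
      intro a ha
      exact ⟨⟨a, Algebra.subset_adjoin (hp ha)⟩, rfl⟩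
    obtain ⟨p', rfl⟩ := this
    exact ⟨p', evalAt_eq R x p'⟩
  have hC : IntermediateField.adjoin K (C : Set M) = ⊤ := by
    rw [eq_top_iff, ← hA, IntermediateField.adjoin_le_iff]
    have : A ≤ (IntermediateField.adjoin K (C : Set M)).toSubalgebra := by
      rw [← hs]
      refine Algebra.adjoin_le fun m hm => ?_
      change m ∈ IntermediateField.adjoin K (C : Set M)
      rw [hPQ m]
      have hmt : (P m).coeffs ∪ (Q m).coeffs ⊆ t :=
        Finset.subset_biUnion_of_mem (fun m => (P m).coeffs ∪ (Q m).coeffs) hm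
      exact div_mem
        (IntermediateField.subset_adjoin K _ (hlift _ (Finset.union_subset_left hmt)))
        (IntermediateField.subset_adjoin K _ (hlift _ (Finset.union_subset_right hmt)))
    exact this
  have hinj := evalAt_injective R hx
  -- Write `l` as `p(x) / q(x)` over `R`; by independence `p = l * q`, so `l` is a quotient of
  -- matching coefficients.
  have hRfrac : ∀ l : L, ∃ a b : R, l = a / b := by
    intro l
    have := (isFractionRing_iff_adjoin_eq_top C).2 hC
    obtain ⟨⟨_, p, rfl⟩, ⟨_, q, rfl⟩, hq, hpq⟩ :=
      IsFractionRing.div_surjective (A := C) (algebraMap L M l)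
    have hq0 : evalAt R x q ≠ 0 := fun h => nonZeroDivisors.ne_zero hq (Subtype.ext h)
    have hpq : evalAt R x p / evalAt R x q = algebraMap L M l := hpq
    rw [div_eq_iff hq0, evalAt_eq, evalAt_eq] at hpq
    have h1 : MvPolynomial.map (algebraMap R L) p =
        MvPolynomial.C l * MvPolynomial.map (algebraMap R L) q := by
      apply hx
      simpa using hpq
    have hq0' : q ≠ 0 := by
      rintro rfl
      exact hq0 (map_zero _)
    obtain ⟨α, hα⟩ := MvPolynomial.ne_zero_iff.1 hq0'
    refine ⟨p.coeff α, q.coeff α, ?_⟩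
    have h2 := congrArg (MvPolynomial.coeff α) h1
    rw [MvPolynomial.coeff_C_mul, MvPolynomial.coeff_map, MvPolynomial.coeff_map] at h2
    have h3 : ((q.coeff α : R) : L) ≠ 0 := by simpa using hα
    rw [eq_div_iff h3]
    exact h2.symm
  have hRinf : Infinite R := by
    by_contra hfin
    rw [not_infinite_iff_finite] at hfin
    have : Finite L := Finite.of_surjective (fun ab : R × R => (ab.1 : L) / ab.2) fun l => by
      obtain ⟨a, b, h⟩ := hRfrac l
      exact ⟨(a, b), h.symm⟩
    exact not_finite L
  have hR : IntermediateField.adjoin K (R : Set L) = ⊤ := by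
    refine eq_top_iff.2 fun l _ => ?_
    obtain ⟨a, b, rfl⟩ := hRfrac l
    exact div_mem (IntermediateField.subset_adjoin K _ a.2)
      (IntermediateField.subset_adjoin K _ b.2)
  obtain ⟨a, c, ha, hc, hac⟩ := exists_awayIn_eq_awayIn ⟨s, hs⟩ hCfg hA hC
  have hD : IsRetractAlgebra K (C.awayIn c) := by
    rw [← hac]
    let := (Subalgebra.inclusion (A.le_awayIn a)).toRingHom.toAlgebra
    have : IsScalarTower K A (A.awayIn a) := IsScalarTower.of_algebraMap_eq fun _ => rfl
    have := Subalgebra.isLocalization_away_awayIn ha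
    exact hret.away ha
  let e : MvPolynomial σ R ≃ₐ[K] C := AlgEquiv.ofInjective (evalAt R x) hinj
  obtain ⟨p, rfl⟩ := e.surjective c
  have hp : p ≠ 0 := by
    rintro rfl
    exact hc (map_zero e)
  obtain ⟨v, hv⟩ : ∃ v : σ → R, MvPolynomial.eval v p ≠ 0 := by
    by_contra! hall
    exact hp (MvPolynomial.funext fun v => by rw [hall v, map_zero])
  -- Evaluation at `v` sends the inverted `p` to `b`, hence extends to a map from `R[x][1/p]` to
  -- `R[1/b]`.
  let b : R := MvPolynomial.eval v p
  let := (Subalgebra.inclusion (R.le_awayIn b)).toRingHom.toAlgebra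
  have : IsScalarTower K R (R.awayIn b) := IsScalarTower.of_algebraMap_eq fun _ => rfl
  have := Subalgebra.isLocalization_away_awayIn hv
  let := (Subalgebra.inclusion (C.le_awayIn (e p))).toRingHom.toAlgebra
  have : IsScalarTower K C (C.awayIn (e p)) := IsScalarTower.of_algebraMap_eq fun _ => rfl
  have := Subalgebra.isLocalization_away_awayIn hc
  let ev : C →ₐ[K] R := ((MvPolynomial.aeval v).restrictScalars K).comp e.symm.toAlgHom
  have hev : ∀ q, ev (e q) = MvPolynomial.eval v q := by
    intro q
    change MvPolynomial.aeval v (e.symm (e q)) = _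
    rw [AlgEquiv.symm_apply_apply, MvPolynomial.aeval_eq_eval]
  have hbu : IsUnit (algebraMap R (R.awayIn b) b) := IsLocalization.Away.algebraMap_isUnit b
  obtain ⟨l₁, hl₁⟩ := exists_away_lift (S := C.awayIn (e p)) (e p)
    ((Algebra.algHom K R (R.awayIn b)).comp ev) (by
      change IsUnit (algebraMap R (R.awayIn b) (ev (e p)))
      rwa [hev])
  have hl₁ : ∀ q, l₁ (algebraMap C _ (e q)) = algebraMap R (R.awayIn b) (MvPolynomial.eval v q) :=
    fun q => by
      rw [← hev]
      exact hl₁ _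
  let ι : R →ₐ[K] C.awayIn (e p) :=
    ((Algebra.algHom K C _).comp e.toAlgHom).comp (Algebra.algHom K R (MvPolynomial σ R))
  have hι : ∀ r, l₁ (ι r) = algebraMap R (R.awayIn b) r := fun r =>
    (hl₁ (MvPolynomial.C r)).trans (by rw [MvPolynomial.eval_C])
  have hιb : ι b ≠ 0 := fun h0 => by
    have h1 := hι b
    rw [h0, map_zero] at h1
    have h2 : ((b : R) : L) = 0 := congrArg (fun m : R.awayIn b => (m : L)) h1.symm
    exact hv (Subtype.ext h2)
  -- The inclusion of `R` extends to `R[1/b]` only after `b` is inverted in `R[x][1/p]` too;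
  -- evaluation then retracts `T` onto `R[1/b]`.
  let T := Localization.Away (ι b)
  have hT : IsRetractAlgebra K T := hD.away hιb
  obtain ⟨l₂, hl₂⟩ := exists_away_lift (S := T) (ι b) l₁ (by rwa [hι])
  obtain ⟨l₃, hl₃⟩ := exists_away_lift (S := R.awayIn b) b ((Algebra.algHom K _ T).comp ι)
    (IsLocalization.Away.algebraMap_isUnit (ι b))
  refine ⟨R.awayIn b, ?_, hT.of_retract l₃ l₂ ?_⟩
  · rw [eq_top_iff, ← hR]
    exact IntermediateField.adjoin.mono K _ _ (R.le_awayIn b)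
  · refine away_algHom_congr b (l := l₂.comp l₃) (m := AlgHom.id K _) fun r => ?_
    simp only [AlgHom.comp_apply, hl₃, AlgHom.id_apply]
    exact (hl₂ (ι r)).trans (hι r)

end Stability

/-! ### Transport to intermediate fields of a common field. -/

section Transport

variable {K M : Type*} [Field K] [Field M] [Algebra K M]

theorem IsRetractRationalExt.of_algEquiv {L L' : Type*} [Field L] [Field L'] [Algebra K L]
    [Algebra K L'] (e : L ≃ₐ[K] L') (h : IsRetractRationalExt K L) :
    IsRetractRationalExt K L' := by
  rw [isRetractRationalExt_iff] at h ⊢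
  obtain ⟨A, hA, hret⟩ := h
  refine ⟨A.map e.toAlgHom, ?_, hret.of_algEquiv (e.subalgebraMap A)⟩
  have h1 := congrArg (IntermediateField.map e.toAlgHom) hA
  rw [IntermediateField.adjoin_map] at h1
  refine h1.trans ?_
  rw [← AlgHom.fieldRange_eq_map, AlgHom.fieldRange_eq_top]
  exact e.surjective

theorem isRetractRationalExt_congr {L L' : Type*} [Field L] [Field L'] [Algebra K L]
    [Algebra K L'] (e : L ≃ₐ[K] L') : IsRetractRationalExt K L ↔ IsRetractRationalExt K L' :=
  ⟨.of_algEquiv e, .of_algEquiv e.symm⟩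

/-- Retract rationality is insensitive to finite purely transcendental extensions. -/
theorem isRetractRationalExt_iff_of_algebraicIndependent {σ : Type*} [Finite σ]
    {A B : IntermediateField K M} [Infinite A] {z : σ → M} (hz : AlgebraicIndependent A z)
    (hB : IntermediateField.adjoin K ((A : Set M) ∪ Set.range z) = B) :
    IsRetractRationalExt K A ↔ IsRetractRationalExt K B := by
  have hAB : A ≤ B := by
    rw [← hB]
    exact fun a ha => IntermediateField.subset_adjoin K _ (Or.inl ha)
  let := (IntermediateField.inclusion hAB).toRingHom.toAlgebra
  have : IsScalarTower K A B := IsScalarTower.of_algebraMap_eq fun _ => rfl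
  have : IsScalarTower A B M := IsScalarTower.of_algebraMap_eq fun _ => rfl
  have hzB : ∀ i, z i ∈ B := by
    rw [← hB]
    exact fun i => IntermediateField.subset_adjoin K _ (Or.inr ⟨i, rfl⟩)
  let z' : σ → B := fun i => ⟨z i, hzB i⟩
  have hz' : AlgebraicIndependent A z' :=
    AlgebraicIndependent.of_comp (IsScalarTower.toAlgHom A B M) hz
  have htop : IntermediateField.adjoin A (Set.range z') = ⊤ := by
    let F := IntermediateField.adjoin A (Set.range z')
    have h1 : B ≤ (F.restrictScalars K).map B.val := by
      conv_lhs => rw [← hB]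
      rw [IntermediateField.adjoin_le_iff]
      rintro m (hm | ⟨i, rfl⟩)
      · exact ⟨⟨m, hAB hm⟩, F.algebraMap_mem ⟨m, hm⟩, rfl⟩
      · exact ⟨z' i, IntermediateField.subset_adjoin A _ ⟨i, rfl⟩, rfl⟩
    refine eq_top_iff.2 fun b _ => ?_
    obtain ⟨b', hb', hbb⟩ := h1 b.2
    have : b' = b := Subtype.ext hbb
    exact this ▸ hb'
  exact ⟨.of_purelyTranscendental hz' htop, .of_algebraicIndependent_adjoin_eq_top hz' htop⟩

end Transport

/-! ### Adding and dropping permuted variables. -/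

section Generators

variable {K M : Type*} [Field K] [Field M] [Algebra K M]

theorem adjoin_adjoin_union (s t : Set M) :
    IntermediateField.adjoin K ((IntermediateField.adjoin K s : Set M) ∪ t) =
      IntermediateField.adjoin K (s ∪ t) := by
  refine le_antisymm ?_ (IntermediateField.adjoin.mono K _ _
    (Set.union_subset_union_left t (IntermediateField.subset_adjoin K s)))
  rw [IntermediateField.adjoin_le_iff]
  rintro x (hx | hx)
  · exact IntermediateField.adjoin.mono K _ _ Set.subset_union_left hx
  · exact IntermediateField.subset_adjoin K _ (Or.inr hx)

theorem AlgebraicIndependent.adjoin_of_sumElim {ι κ : Type*} {s : ι → M} {t : κ → M}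
    (h : AlgebraicIndependent K (Sum.elim t s)) :
    AlgebraicIndependent (IntermediateField.adjoin K (Set.range s)) t :=
  IntermediateField.algebraicIndependent_adjoin_iff.2 (AlgebraicIndependent.sumElim_iff.1 h).2

theorem map_mem_adjoin {N : Type*} [Field N] [Algebra K N] {s : Set M} (α : M →ₐ[K] N)
    {E : IntermediateField K N} (h : ∀ x ∈ s, α x ∈ E) :
    ∀ x ∈ IntermediateField.adjoin K s, α x ∈ E := by
  have : IntermediateField.adjoin K s ≤ E.comap α := by
    rw [IntermediateField.adjoin_le_iff]
    exact h
  exact this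

/-- Adding finitely many permuted independent variables to a faithfully permuted family does not
change the retract rationality of the field of invariants. -/
theorem isRetractRationalExt_invariants_iff {G ι κ : Type*} [Group G] [Finite G] [Nonempty ι]
    [Finite κ] (ρ : G →* (M ≃ₐ[K] M)) {s : ι → M} {t : κ → M}
    (hst : AlgebraicIndependent K (Sum.elim t s))
    (hs : ∀ g i, ∃ i', ρ g (s i) = s i') (ht : ∀ g k, ∃ k', ρ g (t k) = t k')
    (hf : ∀ g, (∀ i, ρ g (s i) = s i) → g = 1) :
    IsRetractRationalExt K (IntermediateField.adjoin K (Set.range s) ⊓ invariants ρ :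
        IntermediateField K M) ↔
      IsRetractRationalExt K (IntermediateField.adjoin K (Set.range s ∪ Set.range t) ⊓
        invariants ρ : IntermediateField K M) := by
  have hE : ∀ g, ∀ e ∈ IntermediateField.adjoin K (Set.range s),
      ρ g e ∈ IntermediateField.adjoin K (Set.range s) := by
    intro g
    refine map_mem_adjoin (ρ g).toAlgHom ?_
    rintro _ ⟨i, rfl⟩
    obtain ⟨i', hi'⟩ := hs g i
    exact IntermediateField.subset_adjoin K _ ⟨i', hi'.symm⟩
  have hfE : ∀ g, (∀ e ∈ IntermediateField.adjoin K (Set.range s), ρ g e = e) → g = 1 :=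
    fun g hg => hf g fun i => hg _ (IntermediateField.subset_adjoin K _ ⟨i, rfl⟩)
  obtain ⟨z, hz, hB⟩ := exists_algebraicIndependent_invariants ρ _ hE hfE t hst.adjoin_of_sumElim
    fun g k => by
      obtain ⟨k', hk'⟩ := ht g k
      rw [hk']
      exact Submodule.subset_span ⟨k', rfl⟩
  rw [adjoin_adjoin_union] at hB
  have hs' : AlgebraicIndependent K s := (AlgebraicIndependent.sumElim_iff.1 hst).1
  have i : ι := Classical.arbitrary ι
  -- The transcendental `s i` is integral over the invariants, which are therefore infinite even if
  -- `K` is finite; stability needs this.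
  have := infinite_inf_invariants ρ _ hE (IntermediateField.subset_adjoin K _ ⟨i, rfl⟩)
    (hs'.transcendental i)
  exact isRetractRationalExt_iff_of_algebraicIndependent hz hB

end Generators

/-! ### Rational function fields, substitution and models of Noether's field. -/

section RationalFunctions

variable {K M : Type*} [Field K] [Field M] [Algebra K M] {ι : Type*}

/-- The variable `x(i)` of the rational function field. -/
noncomputable def ratVar (K : Type*) [Field K] {ι : Type*} (i : ι) :
    FractionRing (MvPolynomial ι K) :=
  algebraMap (MvPolynomial ι K) _ (MvPolynomial.X i)

theorem algebraicIndependent_ratVar :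
    AlgebraicIndependent K (ratVar K : ι → FractionRing (MvPolynomial ι K)) :=
  (MvPolynomial.algebraicIndependent_X ι K).map' (f := Algebra.algHom K _ _)
    (IsFractionRing.injective _ _)

theorem ratFun_algHom_ext {α β : FractionRing (MvPolynomial ι K) →ₐ[K] M}
    (h : ∀ i, α (ratVar K i) = β (ratVar K i)) : α = β := by
  refine IsLocalization.algHom_ext (nonZeroDivisors (MvPolynomial ι K)) ?_
  exact MvPolynomial.algHom_ext h

/-- Substitution of algebraically independent elements into rational functions. -/
noncomputable def ratSubst {y : ι → M} (hy : AlgebraicIndependent K y) :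
    FractionRing (MvPolynomial ι K) →ₐ[K] M :=
  IsFractionRing.liftAlgHom (g := MvPolynomial.aeval y) hy

theorem ratSubst_ratVar {y : ι → M} (hy : AlgebraicIndependent K y) (i : ι) :
    ratSubst hy (ratVar K i) = y i := by
  exact (IsFractionRing.lift_algebraMap (g := (MvPolynomial.aeval y : _ →ₐ[K] M).toRingHom) hy
    (MvPolynomial.X i)).trans (MvPolynomial.aeval_X y i)

theorem adjoin_ratVar :
    IntermediateField.adjoin K (Set.range (ratVar K : ι → FractionRing (MvPolynomial ι K))) = ⊤ := by
  refine eq_top_iff.2 fun x _ => ?_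
  have h : ∀ p : MvPolynomial ι K, algebraMap _ (FractionRing (MvPolynomial ι K)) p ∈
      IntermediateField.adjoin K (Set.range (ratVar K : ι → FractionRing (MvPolynomial ι K))) := by
    intro p
    induction p using MvPolynomial.induction_on with
    | C a => exact IntermediateField.algebraMap_mem _ a
    | add p q hp hq => rw [map_add]; exact add_mem hp hq
    | mul_X p i hp =>
      rw [map_mul]
      exact mul_mem hp (IntermediateField.subset_adjoin K _ ⟨i, rfl⟩)
  obtain ⟨a, b, -, rfl⟩ := IsFractionRing.div_surjective (A := MvPolynomial ι K) x
  exact div_mem (h a) (h b)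

theorem fieldRange_ratSubst {y : ι → M} (hy : AlgebraicIndependent K y) :
    (ratSubst hy).fieldRange = IntermediateField.adjoin K (Set.range y) := by
  rw [AlgHom.fieldRange_eq_map, ← adjoin_ratVar, IntermediateField.adjoin_map, ← Set.range_comp]
  congr 2
  ext i
  exact ratSubst_ratVar hy i

/-- A model of Noether's field inside `M`. -/
theorem isRetractRationalExt_noetherField_iff {G : Type*} [Group G] (ρ : G →* (M ≃ₐ[K] M))
    {y : G → M} (hy : AlgebraicIndependent K y) (hρ : ∀ h g, ρ h (y g) = y (h * g)) :
    IsRetractRationalExt K (noetherField K G) ↔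
      IsRetractRationalExt K (IntermediateField.adjoin K (Set.range y) ⊓ invariants ρ :
        IntermediateField K M) := by
  have heq : ∀ h f, ρ h (ratSubst hy f) = ratSubst hy (regularFieldAction K G h f) := by
    intro h f
    refine DFunLike.congr_fun (f := (ρ h).toAlgHom.comp (ratSubst hy))
      (g := (ratSubst hy).comp (regularFieldAction K G h).toAlgHom) ?_ f
    refine ratFun_algHom_ext fun g => ?_
    have h1 : regularFieldAction K G h (ratVar K g) = ratVar K (h * g) :=
      regularFieldAction_X K G h g
    simp [ratSubst_ratVar, hρ, h1]
  have hmap : (noetherField K G).map (ratSubst hy) =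
      IntermediateField.adjoin K (Set.range y) ⊓ invariants ρ := by
    rw [← fieldRange_ratSubst hy]
    ext m
    constructor
    · rintro ⟨f, hf, rfl⟩
      refine ⟨⟨f, rfl⟩, mem_invariants.2 fun h => ?_⟩
      exact (heq h f).trans (congrArg _ ((mem_noetherField_iff K G f).1 hf h))
    · rintro ⟨⟨f, rfl⟩, hm⟩
      refine ⟨f, (mem_noetherField_iff K G f).2 fun h => ?_, rfl⟩
      apply (ratSubst hy).injective
      exact (heq h f).symm.trans (mem_invariants.1 hm h)
  rw [← hmap]
  exact isRetractRationalExt_congr (IntermediateField.equivMap _ _)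

end RationalFunctions

/-! ### Generators of a stably rational Noether field with added variables. -/

section StablyRational

variable {K : Type*} [Field K] {H : Type*} [Group H]

/-- The inclusion `K(x(h) : h ∈ H) → K(x(h), w(i) : h ∈ H, i ∈ ι)`. -/
noncomputable def ratInl (K H ι : Type*) [Field K] :
    FractionRing (MvPolynomial H K) →ₐ[K] FractionRing (MvPolynomial (H ⊕ ι) K) :=
  ratSubst (algebraicIndependent_ratVar.comp Sum.inl Sum.inl_injective)

theorem ratInl_ratVar (K : Type*) {H ι : Type*} [Field K] (h : H) :
    ratInl K H ι (ratVar K h) = ratVar K (Sum.inl h) :=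
  ratSubst_ratVar _ h

/-- Bounds the number of generators of `K(H)(w)` by the transcendence degree of the ambient field.
Only this bound is kept: independence of their copies is recovered later by counting. -/
theorem card_le_of_algebraicIndependent {ι : Type*} [Finite ι]
    {s : Set (FractionRing (MvPolynomial ι K))}
    (hs : AlgebraicIndependent K ((↑) : s → FractionRing (MvPolynomial ι K))) :
    s.Finite ∧ s.ncard ≤ Nat.card ι := by
  have hb : IsTranscendenceBasis K (ratVar K : ι → FractionRing (MvPolynomial ι K)) := by
    have : Algebra.IsAlgebraic (MvPolynomial ι K) (FractionRing (MvPolynomial ι K)) :=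
      IsLocalization.isAlgebraic _ (nonZeroDivisors _)
    have := (IsTranscendenceBasis.mvPolynomial ι K).algebraMap_comp
      (A := FractionRing (MvPolynomial ι K))
    exact this
  have h1 := hb.lift_cardinalMk_eq_trdeg
  have h2 := hs.lift_cardinalMk_le_trdeg
  rw [Cardinal.lift_id, Cardinal.lift_id] at h2
  rw [← Nat.cast_card (α := ι), Cardinal.lift_natCast, eq_comm,
    Cardinal.lift_eq_nat_iff] at h1
  rw [h1] at h2
  have hfin : s.Finite := Cardinal.lt_aleph0_iff_set_finite.1
    (h2.trans_lt (Cardinal.natCast_lt_aleph0))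
  refine ⟨hfin, ?_⟩
  have := hfin.to_subtype
  rw [← Nat.cast_card (α := s)] at h2
  exact_mod_cast h2

/-- Independence of `w` over a field containing the image of `τ` extends `τ` to an embedding of
`L(w)` into `M`; the rational generators are carried along it. -/
theorem IsRationalExt.exists_generators {L M ι : Type*} [Field L] [Field M] [Algebra K L]
    [Algebra K M] (h : IsRationalExt K (FractionRing (MvPolynomial ι L))) (τ : L →ₐ[K] M)
    (E : IntermediateField K M) (hτ : ∀ l, τ l ∈ E) {w : ι → M} (hw : AlgebraicIndependent E w) :
    ∃ s : Set M, AlgebraicIndependent K ((↑) : s → M) ∧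
      IntermediateField.adjoin K s = IntermediateField.adjoin K (Set.range τ ∪ Set.range w) := by
  obtain ⟨s, hs, hs'⟩ := h
  let := τ.toRingHom.toAlgebra
  have : IsScalarTower K L M := IsScalarTower.of_algebraMap_eq fun k => (τ.commutes k).symm
  let ιE : L →+* E := τ.toRingHom.codRestrict E hτ
  let := ιE.toAlgebra
  have : IsScalarTower L E M := IsScalarTower.of_algebraMap_eq fun _ => rfl
  have hwL : AlgebraicIndependent L w := hw.restrictScalars (K := E) ιE.injective
  let κ : FractionRing (MvPolynomial ι L) →ₐ[K] M := (ratSubst hwL).restrictScalars K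
  refine ⟨κ '' s, ?_, ?_⟩
  · have := (hs.map' (f := κ) κ.injective).coe_range
    rwa [Set.range_comp, Subtype.range_coe] at this
  rw [← IntermediateField.adjoin_map, hs', ← AlgHom.fieldRange_eq_map]
  refine le_antisymm ?_ ?_
  · let F : IntermediateField L M :=
      { (IntermediateField.adjoin K (Set.range τ ∪ Set.range w)).toSubfield with
        algebraMap_mem' := fun l => IntermediateField.subset_adjoin K _ (Or.inl ⟨l, rfl⟩) }
    have hF : (ratSubst hwL).fieldRange ≤ F := by
      rw [fieldRange_ratSubst, IntermediateField.adjoin_le_iff]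
      exact fun x hx => IntermediateField.subset_adjoin K _ (Or.inr hx)
    rintro _ ⟨f, rfl⟩
    exact hF ⟨f, rfl⟩
  · rw [IntermediateField.adjoin_le_iff]
    rintro _ (⟨l, rfl⟩ | ⟨i, rfl⟩)
    · exact ⟨algebraMap L _ l, (ratSubst hwL).commutes l⟩
    · exact ⟨ratVar L i, ratSubst_ratVar hwL i⟩

/-- If `K(H)` is stably rational, then `K(H)(w₁, …, wₘ)`, realized inside
`K(x(h), w(i))`, is generated by at most `|H| + m` elements. -/
theorem exists_generators_of_isStablyRationalExt [Finite H]
    (hH : IsStablyRationalExt K (noetherField K H)) :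
    ∃ (m r : ℕ) (u : Fin r → FractionRing (MvPolynomial (H ⊕ Fin m) K)),
      r ≤ Nat.card H + m ∧ IntermediateField.adjoin K (Set.range u) =
        IntermediateField.adjoin K (ratInl K H (Fin m) '' (noetherField K H) ∪
          Set.range fun i => ratVar K (Sum.inr i)) := by
  obtain ⟨m, hm⟩ := hH
  have hind : AlgebraicIndependent K (Sum.elim (fun i => ratVar K (Sum.inr i))
      (fun h => ratVar K (Sum.inl h)) : Fin m ⊕ H → FractionRing (MvPolynomial (H ⊕ Fin m) K)) := by
    have := (algebraicIndependent_ratVar (K := K) (ι := H ⊕ Fin m)).comp _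
      (Equiv.sumComm (Fin m) H).injective
    convert this using 1
    ext (i | h) <;> rfl
  have hτE : ∀ f, ratInl K H (Fin m) f ∈
      IntermediateField.adjoin K (Set.range fun h : H => ratVar K (Sum.inl h)) := by
    intro f
    have : (ratInl K H (Fin m)).fieldRange = _ := fieldRange_ratSubst _
    exact this ▸ AlgHom.mem_fieldRange.2 ⟨f, rfl⟩
  obtain ⟨s, hs, hgen⟩ := hm.exists_generators
    ((ratInl K H (Fin m)).comp (noetherField K H).val) _ (fun l => hτE l) hind.adjoin_of_sumElim
  obtain ⟨hfin, hcard⟩ := card_le_of_algebraicIndependent hs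
  have := hfin.to_subtype
  let e := Finite.equivFin s
  refine ⟨m, Nat.card s, fun i => e.symm i, ?_, ?_⟩
  · rw [Nat.card_coe_set_eq]
    simpa using hcard
  · have h1 : (Set.range fun i => ((e.symm i : s) : FractionRing (MvPolynomial (H ⊕ Fin m) K))) =
        s := by
      rw [show (fun i => ((e.symm i : s) : FractionRing (MvPolynomial (H ⊕ Fin m) K))) =
        Subtype.val ∘ e.symm from rfl, Set.range_comp, e.symm.surjective.range_eq, Set.image_univ,
        Subtype.range_coe]
    rw [h1, hgen]
    congr 2
    ext x
    constructor
    · rintro ⟨l, rfl⟩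
      exact ⟨l, l.2, rfl⟩
    · rintro ⟨l, hl, rfl⟩
      exact ⟨⟨l, hl⟩, rfl⟩

end StablyRational

/-! ### Invariants of a power of `H` on several copies of its variables. -/

section Wreath

/-- The permutations of the variables of a rational function field. -/
noncomputable def permFieldAction (K X : Type*) [Field K] :
    Equiv.Perm X →* (FractionRing (MvPolynomial X K) ≃ₐ[K] FractionRing (MvPolynomial X K)) :=
  (IsFractionRing.fieldEquivOfAlgEquivHom K (FractionRing (MvPolynomial X K))).comp
    { toFun := fun e => MvPolynomial.renameEquiv K e
      map_one' := by ext p; simp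
      map_mul' := fun a b => by ext p; simp [MvPolynomial.rename_rename, Function.comp_def] }

theorem permFieldAction_ratVar (K : Type*) {X : Type*} [Field K] (e : Equiv.Perm X) (i : X) :
    permFieldAction K X e (ratVar K i) = ratVar K (e i) := by
  simp [permFieldAction, ratVar]

/-- A family of maps compatible with multiplication, as a permutation representation. -/
def toPermHomOfFun {Γ X : Type*} [Group Γ] (f : Γ → X → X) (h₁ : ∀ x, f 1 x = x)
    (hm : ∀ a b x, f (a * b) x = f a (f b x)) : Γ →* Equiv.Perm X :=
  MonoidHom.toHomPerm
    { toFun := f, map_one' := funext h₁, map_mul' := fun a b => funext (hm a b) }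

variable {K M : Type*} [Field K] [Field M] [Algebra K M]
  {H J ι : Type*} [Group H] [Finite H] [Finite J]

theorem isIntegral_noetherField (K H : Type*) [Field K] [Group H] [Finite H]
    (f : FractionRing (MvPolynomial H K)) : IsIntegral (noetherField K H) f :=
  isIntegral_of_orbit_mem (E := ⊤) (regularFieldAction K H) inf_le_right
    fun _ => IntermediateField.mem_top

/-- The multiplicative map `f ↦ ∏ j, θ j (f j)`. -/
noncomputable def prodAlgHom {R J : Type*} [Fintype J] [Field R] [Algebra K R]
    (θ : J → R →ₐ[K] M) : (J → R) →* M where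
  toFun f := ∏ j, θ j (f j)
  map_one' := by simp
  map_mul' f g := by simp [Finset.prod_mul_distrib]

theorem prodAlgHom_apply {R J : Type*} [Fintype J] [Field R] [Algebra K R]
    (θ : J → R →ₐ[K] M) (f : J → R) : prodAlgHom θ f = ∏ j, θ j (f j) :=
  rfl

theorem mem_mrange_prodAlgHom {R J : Type*} [Fintype J] [Field R] [Algebra K R]
    (θ : J → R →ₐ[K] M) (j : J) (a : R) : θ j a ∈ MonoidHom.mrange (prodAlgHom θ) := by
  classical
  refine ⟨Pi.mulSingle j a, ?_⟩
  rw [prodAlgHom_apply, Fintype.prod_eq_single j fun j' hj' => by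
    rw [Pi.mulSingle_eq_of_ne hj', map_one], Pi.mulSingle_eq_same]

/-- The invariants of `∏ j, H` acting on the variables `q (j, h)`: they are generated by the images
`v` of generators of `K(H)(w)` under the embeddings indexed by `J`. -/
theorem adjoin_inf_invariants_eq_of_pi
    {r : ℕ} {u : Fin r → FractionRing (MvPolynomial (H ⊕ ι) K)}
    (hu : IntermediateField.adjoin K (Set.range u) =
        IntermediateField.adjoin K (ratInl K H ι '' (noetherField K H) ∪
          Set.range fun i => ratVar K (Sum.inr i)))
    (ρ : (J → H) →* (M ≃ₐ[K] M)) {x : J → H ⊕ ι → M} (hx : ∀ j, AlgebraicIndependent K (x j))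
    {y : Set M} (hy : ∀ n, ∀ a ∈ y, ρ n a = a)
    (hH : ∀ n j h, ρ n (x j (Sum.inl h)) = x j (Sum.inl (n j * h)))
    (hι : ∀ n j i, ρ n (x j (Sum.inr i)) = x j (Sum.inr i)) :
    let v : J × Fin r → M := fun k => ratSubst (hx k.1) (u k.2)
    (∀ j p, IsIntegral (IntermediateField.adjoin K (y ∪ Set.range v)) (x j p)) ∧
    IntermediateField.adjoin K (y ∪ Set.range (fun k : J × (H ⊕ ι) => x k.1 k.2)) ⊓ invariants ρ =
      IntermediateField.adjoin K (y ∪ Set.range v) := by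
  classical
  intro v
  have := Fintype.ofFinite J
  have := Fintype.ofFinite H
  set F := IntermediateField.adjoin K (y ∪ Set.range v) with hF
  let θ : J → FractionRing (MvPolynomial H K) →ₐ[K] M := fun j =>
    (ratSubst (hx j)).comp (ratInl K H ι)
  have hθ : ∀ j h, θ j (ratVar K h) = x j (Sum.inl h) := fun j h => by
    simp [θ, ratInl_ratVar, ratSubst_ratVar]
  have hvF : ∀ k, v k ∈ F := fun k => IntermediateField.subset_adjoin K _ (Or.inr ⟨k, rfl⟩)
  have huF : ∀ j, ∀ a ∈ IntermediateField.adjoin K (Set.range u), ratSubst (hx j) a ∈ F := by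
    intro j
    refine map_mem_adjoin _ ?_
    rintro _ ⟨i, rfl⟩
    exact hvF (j, i)
  rw [hu] at huF
  have hθF : ∀ j, ∀ f ∈ noetherField K H, θ j f ∈ F := fun j f hf =>
    huF j _ (IntermediateField.subset_adjoin K _ (Or.inl ⟨f, hf, rfl⟩))
  have hιF : ∀ j i, x j (Sum.inr i) ∈ F := by
    intro j i
    have := huF j _ (IntermediateField.subset_adjoin K _ (Or.inr ⟨i, rfl⟩))
    rwa [ratSubst_ratVar] at this
  have hθint : ∀ j f, IsIntegral F (θ j f) := by
    intro j f
    refine (isIntegral_noetherField K H f).map_of_comp_eq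
      (((θ j).comp (noetherField K H).val).toRingHom.codRestrict F fun f => hθF j f f.2)
      (θ j).toRingHom ?_
    ext
    rfl
  have hxint : ∀ j p, IsIntegral F (x j p) := by
    rintro j (h | i)
    · rw [← hθ]
      exact hθint j _
    · exact isIntegral_algebraMap (R := F) (x := ⟨_, hιF j i⟩)
  have heq : ∀ n j f, ρ n (θ j f) = θ j (regularFieldAction K H (n j) f) := by
    intro n j f
    refine DFunLike.congr_fun (f := (ρ n).toAlgHom.comp (θ j))
      (g := (θ j).comp (regularFieldAction K H (n j)).toAlgHom) ?_ f
    refine ratFun_algHom_ext fun g => ?_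
    have h1 : regularFieldAction K H (n j) (ratVar K g) = ratVar K (n j * g) :=
      regularFieldAction_X K H (n j) g
    simp [hθ, hH, h1]
  have hvinv : ∀ k, v k ∈ invariants ρ := by
    rintro ⟨j, i⟩
    have h1 : ∀ a ∈ IntermediateField.adjoin K (Set.range u),
        ratSubst (hx j) a ∈ invariants ρ := by
      rw [hu]
      refine map_mem_adjoin _ ?_
      rintro _ (⟨f, hf, rfl⟩ | ⟨i, rfl⟩)
      · refine mem_invariants.2 fun n => (heq n j f).trans ?_
        rw [(mem_noetherField_iff K H f).1 hf]
        rfl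
      · rw [ratSubst_ratVar]
        exact mem_invariants.2 fun n => hι n j i
    exact h1 _ (IntermediateField.subset_adjoin K _ ⟨i, rfl⟩)
  refine ⟨hxint, ?_⟩
  have hyB : y ⊆ IntermediateField.adjoin K
      (y ∪ Set.range (fun k : J × (H ⊕ ι) => x k.1 k.2)) :=
    fun a ha => IntermediateField.subset_adjoin K _ (Or.inl ha)
  have hxB : ∀ j p, x j p ∈ IntermediateField.adjoin K
      (y ∪ Set.range (fun k : J × (H ⊕ ι) => x k.1 k.2)) :=
    fun j p => IntermediateField.subset_adjoin K _ (Or.inr ⟨(j, p), rfl⟩)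
  have hθS := mem_mrange_prodAlgHom θ
  -- The multiplicative set consists of the products `∏ j, θ j (f j)`.
  refine inf_invariants_eq_of_sum_mem ρ (MonoidHom.mrange (prodAlgHom θ)) ?_ ?_ ?_ ?_ ?_ ?_
  · rw [hF, IntermediateField.adjoin_le_iff]
    rintro _ (ha | ⟨⟨j, i⟩, rfl⟩)
    · exact hyB ha
    · have : ∀ a ∈ IntermediateField.adjoin K (Set.range (ratVar K : H ⊕ ι → _)),
          ratSubst (hx j) a ∈ IntermediateField.adjoin K
            (y ∪ Set.range (fun k : J × (H ⊕ ι) => x k.1 k.2)) := by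
        refine map_mem_adjoin _ ?_
        rintro _ ⟨p, rfl⟩
        rw [ratSubst_ratVar]
        exact hxB j p
      exact this _ (adjoin_ratVar (K := K) ▸ IntermediateField.mem_top)
  · rw [hF, IntermediateField.adjoin_le_iff]
    rintro a (ha | ⟨k, rfl⟩)
    · exact mem_invariants.2 fun n => hy n a ha
    · exact hvinv k
  · rintro _ ⟨f, rfl⟩
    rw [prodAlgHom_apply]
    exact IsIntegral.prod _ fun j _ => hθint j (f j)
  · rintro _ ⟨f, rfl⟩
    -- The trace over `∏ j, H` of a product of factors from separate copies is the product of the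
    -- traces over `H`, each of which lies in a copy of `K(H)`.
    have h1 : ∑ n, ρ n (prodAlgHom θ f) = ∏ j, θ j (∑ h, regularFieldAction K H h (f j)) := by
      simp only [map_sum]
      rw [Finset.prod_univ_sum, Fintype.piFinset_univ]
      refine Finset.sum_congr rfl fun n _ => ?_
      rw [prodAlgHom_apply, map_prod]
      exact Finset.prod_congr rfl fun j _ => heq n j (f j)
    rw [h1]
    exact prod_mem fun j _ => hθF j _ (sum_mem_invariants (regularFieldAction K H) (f j))
  · rw [IntermediateField.adjoin_le_iff]
    rintro _ (ha | ⟨⟨j, h | i⟩, rfl⟩)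
    · exact IntermediateField.subset_adjoin K _
        (Or.inl (IntermediateField.subset_adjoin K _ (Or.inl ha)))
    · have h1 := hθS j (ratVar K h)
      rw [hθ] at h1
      exact IntermediateField.subset_adjoin K _ (Or.inr h1)
    · exact IntermediateField.subset_adjoin K _ (Or.inl (hιF j i))
  · intro n hn
    funext j
    have h1 := hn _ (hxB j (Sum.inl 1))
    rw [hH, mul_one] at h1
    simpa using (hx j).injective h1

end Wreath

/-! ### Comparison of `K(G)` and `K(Γ)` for a split extension. -/

section WreathModel

variable {K H G Γ J : Type*} [Field K] [Group H] [Finite H] [Group G] [Finite G] [Group Γ]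
  [Finite Γ] [Finite J] [MulAction G J]

/-- The comparison of `K(G)` and `K(Γ)`, for `Γ` an extension of `G` by `∏ j : J, H`, inside a field
containing all relevant variables. -/
theorem isRetractRationalExt_iff_of_model {M ι : Type*} [Field M] [Algebra K M] [Finite ι] {r : ℕ}
    {u : Fin r → FractionRing (MvPolynomial (H ⊕ ι) K)} (hr : r ≤ Nat.card H + Nat.card ι)
    (hu : IntermediateField.adjoin K (Set.range u) =
        IntermediateField.adjoin K (ratInl K H ι '' (noetherField K H) ∪
          Set.range fun i => ratVar K (Sum.inr i)))
    (π : Γ →* G) (sec : G →* Γ) (ν : (J → H) →* Γ) (hsec : ∀ g, π (sec g) = g)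
    (hν : ∀ n, π (ν n) = 1) (hgen : ∀ γ, ∃ n g, γ = ν n * sec g) (ρ : Γ →* (M ≃ₐ[K] M))
    {z : Γ → M} {x : J → H ⊕ ι → M} {y : G → M}
    (hind : AlgebraicIndependent K
      (Sum.elim z (Sum.elim (fun k : J × (H ⊕ ι) => x k.1 k.2) y)))
    (hz : ∀ γ γ', ρ γ (z γ') = z (γ * γ')) (hy : ∀ γ g, ρ γ (y g) = y (π γ * g))
    (hxH : ∀ n j h, ρ (ν n) (x j (Sum.inl h)) = x j (Sum.inl (n j * h)))
    (hxι : ∀ n j i, ρ (ν n) (x j (Sum.inr i)) = x j (Sum.inr i))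
    (hxG : ∀ g j p, ρ (sec g) (x j p) = x (g • j) p) :
    IsRetractRationalExt K (noetherField K G) ↔ IsRetractRationalExt K (noetherField K Γ) := by
  set x' : J × (H ⊕ ι) → M := fun k => x k.1 k.2 with hx'
  have hR : AlgebraicIndependent K (Sum.elim x' y) := (AlgebraicIndependent.sumElim_iff.1 hind).1
  have hswap : AlgebraicIndependent K (Sum.elim (Sum.elim x' y) z) := by
    have := hind.comp _ (Equiv.sumComm (J × (H ⊕ ι) ⊕ G) Γ).injective
    convert this using 1
    ext (i | i) <;> rfl
  have hx'i : AlgebraicIndependent K x' := hR.comp Sum.inl Sum.inl_injective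
  have hyi : AlgebraicIndependent K y := hR.comp Sum.inr Sum.inr_injective
  have hzi : AlgebraicIndependent K z := hind.comp Sum.inl Sum.inl_injective
  have hxj : ∀ j, AlgebraicIndependent K (x j) := fun j =>
    hx'i.comp (fun p => (j, p)) (Prod.mk_right_injective j)
  have hxperm : ∀ γ j p, ∃ k, ρ γ (x j p) = x' k := by
    intro γ j p
    obtain ⟨n, g, rfl⟩ := hgen γ
    rw [map_mul, AlgEquiv.mul_apply, hxG]
    obtain h | i := p
    · exact ⟨(g • j, Sum.inl (n (g • j) * h)), hxH _ _ _⟩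
    · exact ⟨(g • j, Sum.inr i), hxι _ _ _⟩
  have hRperm : ∀ γ k, ∃ k', ρ γ (Sum.elim x' y k) = Sum.elim x' y k' := by
    rintro γ (⟨j, p⟩ | g)
    · obtain ⟨k, hk⟩ := hxperm γ j p
      exact ⟨Sum.inl k, hk⟩
    · exact ⟨Sum.inr (π γ * g), hy γ g⟩
  have hzperm : ∀ γ γ₀, ∃ γ', ρ γ (z γ₀) = z γ' := fun γ γ₀ => ⟨γ * γ₀, hz γ γ₀⟩
  -- The variable `y 1` detects the image in `G`, and the variables `x j (Sum.inl 1)` detect the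
  -- remaining element of `∏ j, H`.
  have hRfaithful : ∀ γ, (∀ k, ρ γ (Sum.elim x' y k) = Sum.elim x' y k) → γ = 1 := by
    intro γ hγ
    have h1 : π γ = 1 := by
      have := hγ (Sum.inr 1)
      simp only [Sum.elim_inr, hy, mul_one] at this
      exact hyi.injective this
    obtain ⟨n, g, rfl⟩ := hgen γ
    rw [map_mul, hν, hsec, one_mul] at h1
    subst h1
    rw [map_one, mul_one] at hγ ⊢
    have h2 : n = 1 := by
      funext j
      have := hγ (Sum.inl (j, Sum.inl 1))
      simp only [Sum.elim_inl, hx', hxH, mul_one] at this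
      simpa using (hxj j).injective this
    rw [h2, map_one]
  have step₁ := isRetractRationalExt_noetherField_iff ρ hzi hz
  have step₂ := isRetractRationalExt_invariants_iff ρ hswap hzperm hRperm fun γ hγ => by
    have := hγ 1
    rw [hz, mul_one] at this
    exact hzi.injective this
  have step₃ := isRetractRationalExt_invariants_iff ρ hind hRperm hzperm hRfaithful
  obtain ⟨hint, hinv⟩ := adjoin_inf_invariants_eq_of_pi hu (ρ.comp ν) hxj (y := Set.range y)
    (by
      rintro n _ ⟨g, rfl⟩
      rw [MonoidHom.comp_apply, hy, hν, one_mul]) hxH hxι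
  set v : J × Fin r → M := fun k => ratSubst (hxj k.1) (u k.2) with hv
  -- `Γ` is generated by the images of `ν` and `sec`, so its invariants are the `G`-invariants among
  -- the `N`-invariants.
  have hinvρ : IntermediateField.adjoin K (Set.range (Sum.elim x' y)) ⊓ invariants ρ =
      IntermediateField.adjoin K (Set.range y ∪ Set.range v) ⊓ invariants (ρ.comp sec) := by
    rw [← hinv, Set.Sum.elim_range, Set.union_comm, inf_assoc]
    congr 1
    ext a
    constructor
    · intro ha
      rw [mem_invariants] at ha
      exact ⟨mem_invariants.2 fun n => ha _, mem_invariants.2 fun g => ha _⟩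
    · rintro ⟨h1, h2⟩
      refine mem_invariants.2 fun γ => ?_
      obtain ⟨n, g, rfl⟩ := hgen γ
      rw [map_mul, AlgEquiv.mul_apply]
      have h3 : ρ (sec g) a = a := mem_invariants.1 h2 g
      rw [h3]
      exact mem_invariants.1 h1 n
  -- There are at most as many `v`s as `x`s because `r ≤ |H| + |ι|`, and all `x`s are integral over
  -- `K(y, v)`.
  have hvy : AlgebraicIndependent K (Sum.elim v y) := by
    refine hR.of_card_le_of_isAlgebraic _ ?_ ?_
    · simp only [Nat.card_sum, Nat.card_prod, Nat.card_fin]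
      gcongr
    · have hrange : IntermediateField.adjoin K (Set.range y ∪ Set.range v) =
          IntermediateField.adjoin K (Set.range (Sum.elim v y)) := by
        rw [Set.Sum.elim_range, Set.union_comm]
      rw [hrange] at hint
      rintro (⟨j, p⟩ | g)
      · exact IntermediateField.isAlgebraic_adjoin_iff.1 (hint j p).isAlgebraic
      · have hyg : y g ∈ Algebra.adjoin K (Set.range (Sum.elim v y)) :=
          Algebra.subset_adjoin ⟨Sum.inr g, rfl⟩
        exact isAlgebraic_algebraMap (⟨y g, hyg⟩ : Algebra.adjoin K (Set.range (Sum.elim v y)))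
  -- Acting by `sec g` after substituting `x j` is substituting `x (g • j)`, so copies of the same
  -- `u i` are permuted.
  have hvperm : ∀ g k, ∃ k', ρ.comp sec g (v k) = v k' := by
    rintro g ⟨j, i⟩
    refine ⟨(g • j, i), ?_⟩
    refine DFunLike.congr_fun (f := (ρ (sec g)).toAlgHom.comp (ratSubst (hxj j)))
      (g := ratSubst (hxj (g • j))) ?_ (u i)
    refine ratFun_algHom_ext fun p => ?_
    simp [ratSubst_ratVar, hxG]
  have hysec : ∀ h g, ρ.comp sec h (y g) = y (h * g) := fun h g => by
    rw [MonoidHom.comp_apply, hy, hsec]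
  have step₄ := isRetractRationalExt_invariants_iff (ρ.comp sec) hvy
    (fun h g => ⟨h * g, hysec h g⟩) hvperm fun h hh => by
      have := hh 1
      rw [hysec, mul_one] at this
      exact hyi.injective this
  have step₅ := isRetractRationalExt_noetherField_iff (ρ.comp sec) hyi hysec
  rw [step₅, step₄, ← hinvρ, step₃, Set.union_comm, ← step₂, step₁]

theorem AlgebraicIndependent.sumElim_apply {M A B C : Type*} [Field M] [Algebra K M]
    {x : A ⊕ (B ⊕ C) → M} (hx : AlgebraicIndependent K x) :
    AlgebraicIndependent K (Sum.elim (fun a => x (Sum.inl a))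
      (Sum.elim (fun b => x (Sum.inr (Sum.inl b))) fun c => x (Sum.inr (Sum.inr c)))) := by
  convert hx using 1
  ext (a | b | c) <;> rfl

/-- If `K(H)` is stably rational and `Γ` is a split extension of `G` by `∏ j : J, H` acting
compatibly on `J × H`, then `K(G)` and `K(Γ)` are simultaneously retract rational. -/
theorem isRetractRationalExt_noetherField_iff_of_split
    (hH : IsStablyRationalExt K (noetherField K H))
    (π : Γ →* G) (sec : G →* Γ) (ν : (J → H) →* Γ) (hsec : ∀ g, π (sec g) = g)
    (hν : ∀ n, π (ν n) = 1) (hgen : ∀ γ, ∃ n g, γ = ν n * sec g)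
    (a : Γ →* Equiv.Perm (J × H)) (haν : ∀ n j h, a (ν n) (j, h) = (j, n j * h))
    (hasec : ∀ g j h, a (sec g) (j, h) = (g • j, h)) :
    IsRetractRationalExt K (noetherField K G) ↔ IsRetractRationalExt K (noetherField K Γ) := by
  obtain ⟨m, r, u, hr, hu⟩ := exists_generators_of_isStablyRationalExt hH
  -- The given action on `J × H` is extended to the auxiliary variables, which move only through the
  -- action of `G` on `J`.
  let b : Γ →* Equiv.Perm (J × (H ⊕ Fin m)) := toPermHomOfFun
    (fun γ k => Sum.elim (fun h => Prod.map id Sum.inl (a γ (k.1, h)))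
        (fun i => (π γ • k.1, Sum.inr i)) k.2)
    (by rintro ⟨j, h | i⟩ <;> simp) (by rintro γ γ' ⟨j, h | i⟩ <;> simp [mul_smul])
  have hb : ∀ γ k, b γ k = Sum.elim (fun h => Prod.map id Sum.inl (a γ (k.1, h)))
      (fun i => (π γ • k.1, Sum.inr i)) k.2 := fun γ k => rfl
  let act : Γ →* Equiv.Perm (Γ ⊕ (J × (H ⊕ Fin m) ⊕ G)) :=
    (Equiv.Perm.sumCongrHom _ _).comp ((MulAction.toPermHom Γ Γ).prod
      ((Equiv.Perm.sumCongrHom _ _).comp (b.prod ((MulAction.toPermHom G G).comp π))))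
  refine isRetractRationalExt_iff_of_model (by simpa using hr) hu π sec ν hsec hν hgen
    ((permFieldAction K _).comp act) (z := fun γ => ratVar K (Sum.inl γ))
    (x := fun j p => ratVar K (Sum.inr (Sum.inl (j, p))))
    (y := fun g => ratVar K (Sum.inr (Sum.inr g))) ?_ ?_ ?_ ?_ ?_ ?_
  · exact AlgebraicIndependent.sumElim_apply algebraicIndependent_ratVar
  · intro γ γ'
    exact permFieldAction_ratVar K (act γ) _
  · intro γ g
    exact permFieldAction_ratVar K (act γ) _
  · intro n j h
    refine (permFieldAction_ratVar K (act (ν n)) _).trans ?_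
    change ratVar K (Sum.inr (Sum.inl (b (ν n) (j, Sum.inl h)))) = _
    simp [hb, haν]
  · intro n j i
    refine (permFieldAction_ratVar K (act (ν n)) _).trans ?_
    change ratVar K (Sum.inr (Sum.inl (b (ν n) (j, Sum.inr i)))) = _
    simp [hb, hν]
  · intro g j p
    refine (permFieldAction_ratVar K (act (sec g)) _).trans ?_
    change ratVar K (Sum.inr (Sum.inl (b (sec g) (j, p)))) = _
    obtain h | i := p <;> simp [hb, hasec, hsec]

end WreathModel

/-- The wreath product `H ≀ᵣ G` is `(G → H) ⋊ G`, with `G` acting on `G → H` by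
`(σ • x) g = x (σ⁻¹ g)`. -/
theorem proposition4p1 (K : Type*) [Field K] (H : Type*) [Group H] [Finite H]
    (G : Type*) [Group G] [Finite G]
    (hH : IsStablyRationalExt K (noetherField K H)) :
    (IsRetractRationalExt K (noetherField K G) ↔
      IsRetractRationalExt K (noetherField K (H × G))) ∧
    (IsRetractRationalExt K (noetherField K G) ↔
      IsRetractRationalExt K (noetherField K (H ≀ᵣ G))) := by
  constructor
  -- A single copy of `H`, with `G` acting trivially on the index.
  · let : MulAction G Unit := { smul := fun _ j => j, one_smul := fun _ => rfl,
                                mul_smul := fun _ _ _ => rfl }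
    refine isRetractRationalExt_noetherField_iff_of_split (J := Unit) hH (MonoidHom.snd H G)
      (MonoidHom.inr H G) ((MonoidHom.inl H G).comp (Pi.evalMonoidHom (fun _ => H) ()))
      (fun _ => rfl) (fun _ => rfl) (fun γ => ⟨fun _ => γ.1, γ.2, by ext <;> simp⟩)
      (toPermHomOfFun (fun γ k => (k.1, γ.1 * k.2)) (by simp) (by simp [mul_assoc])) ?_ ?_
    · intro n j h
      rfl
    · intro g j h
      exact Prod.ext rfl (one_mul h)
  · refine isRetractRationalExt_noetherField_iff_of_split (J := G) hH
      RegularWreathProduct.rightHom RegularWreathProduct.inl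
      { toFun := fun n => ⟨n, 1⟩, map_one' := rfl, map_mul' := fun a b => by ext <;> simp }
      (fun _ => rfl) (fun _ => rfl) (fun γ => ⟨γ.left, γ.right, by ext <;> simp⟩)
      -- Since `γ` is its base part times its `G`-part, the index moves first and the base
      -- coordinate is read at the new index.
      (toPermHomOfFun (fun γ k => (γ.right * k.1, γ.left (γ.right * k.1) * k.2))
        (by simp) (by simp [mul_assoc])) ?_ ?_
    · intro n j h
      change (1 * j, n (1 * j) * h) = _
      rw [one_mul]
    · intro g j h
      exact Prod.ext rfl (one_mul h)
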